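/- Let $G=(V,E)$ be a finite simple graph with maximum degree $\Delta=\Delta(G)$. For an edge $e=xy$ put $N[e]=N[x]\cup N[y]$, the union of the closed neighbourhoods of its endpoints. A set $D\subseteq V$ is a *2-ve dominating set* if $|N[e]\cap D|\ge 2$ for every $e\in E$. A set $L\subseteq V$ is a *liar's ve-dominating set* if $|N[e]\cap L|\ge 2$ for every $e\in E$ and $|(N[e]\cup N[f])\cap L|\ge 3$ for all distinct $e,f\in E$. The problem MinLVEDP asks, given $G$, for a liar's ve-dominating set of minimum cardinality. (We use the convention $\ln 0:=0$; for $\Delta=0$ all the optima below are $0$.) **Theorem.** MinLVEDP can be approximated in polynomial time within a factor $O(\ln\Delta(G))$. More precisely, there is an algorithm (a program for the unit-cost random access machine with addition and truncated subtraction, the input being the adjacency matrix of $G$) which, for every finite simple graph $G$ on $n$ vertices, runs for at most a polynomial in $n$ number of steps and outputs a liar's ve-dominating set $L$ of $G$ such that $$|L|\le 2\,(3\ln\Delta(G)+1)\,|L^*|$$ for every liar's ve-dominating set $L^*$ of $G$; and $2(3\ln\Delta+1)=O(\ln\Delta)$ as $\Delta\to\infty$. The algorithm has two phases: 1. First it computes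 a 2-ve dominating set $D$ of $G$ such that $|D|\le(2\ln\Delta(G)+1)\,|D^*|$ for every 2-ve dominating set $D^*$ of $G$. 2. Let $X$ be the set of all unordered pairs $\{e,f\}$ of distinct edges with $|(N[e]\cup N[f])\cap D|=2$, and for $v\in V\setminus D$ let $S_v=\{\{e,f\}\in X: v\in N[e]\cup N[f]\}$. Then $|S_v|\le\Delta(G)^4$ for every $v\in V\setminus D$. The algorithm covers $X$ by greedy set cover: as long as uncovered elements of $X$ remain, it chooses a vertex $v\in V\setminus D$ for which $S_v$ contains the largest number of uncovered elements. With $C$ the set of the chosen vertices, the output is $L=D\cup C$. -/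

import Mathlib

/-! ### Vertex-edge domination -/

namespace LVED

section Graph

variable {V : Type*} [Fintype V] [DecidableEq V]

/-- The closed neighbourhood `N[e] = N[x] ∪ N[y]` of an edge `e = xy`. -/
def edgeNbhd (G : SimpleGraph V) [DecidableRel G.Adj] (e : Sym2 V) : Finset V :=
  Finset.univ.filter fun w => ∃ u, u ∈ e ∧ (w = u ∨ G.Adj u w)

/-- `D` is a `k`-ve dominating set of `G`. -/
def IsKVEDominating (G : SimpleGraph V) [DecidableRel G.Adj] (k : ℕ) (D : Finset V) : Prop :=
  ∀ e ∈ G.edgeFinset, k ≤ (edgeNbhd G e ∩ D).card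

/-- `L` is a liar's ve-dominating set of `G`. -/
def IsLiarVEDominating (G : SimpleGraph V) [DecidableRel G.Adj] (L : Finset V) : Prop :=
  (∀ e ∈ G.edgeFinset, 2 ≤ (edgeNbhd G e ∩ L).card) ∧
  ∀ e ∈ G.edgeFinset, ∀ f ∈ G.edgeFinset, e ≠ f →
    3 ≤ ((edgeNbhd G e ∪ edgeNbhd G f) ∩ L).card

/-- The (unordered) pairs `{e, f}` of distinct edges that are only doubly dominated by `D`, that
is, `|(N[e] ∪ N[f]) ∩ D| = 2`. -/
def doublyDominatedPairs (G : SimpleGraph V) [DecidableRel G.Adj] (D : Finset V) :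
    Finset (Finset (Sym2 V)) :=
  (G.edgeFinset.powersetCard 2).filter fun P => (P.biUnion (edgeNbhd G) ∩ D).card = 2

/-- The pairs `{e, f}` only doubly dominated by `D` for which `v ∈ N[e] ∪ N[f]`. -/
def pairsCoveredBy (G : SimpleGraph V) [DecidableRel G.Adj] (D : Finset V) (v : V) :
    Finset (Finset (Sym2 V)) :=
  (doublyDominatedPairs G D).filter fun P => v ∈ P.biUnion (edgeNbhd G)

end Graph

/-- `GreedySetCover S T U l`: with the sets `S i`, `i ∈ T`, available, and with `U` the set of the
elements that are still uncovered, the greedy set cover algorithm may choose, in this order, the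
sets with the indices listed in `l`, after which everything is covered. In each round a set that
contains the largest number of uncovered elements is chosen. -/
inductive GreedySetCover {ι α : Type*} [DecidableEq α] (S : ι → Finset α) (T : Finset ι) :
    Finset α → List ι → Prop
  | done : GreedySetCover S T ∅ []
  | choose (U : Finset α) (i : ι) (l : List ι) (hU : U.Nonempty) (hi : i ∈ T)
      (hmax : ∀ j ∈ T, (S j ∩ U).card ≤ (S i ∩ U).card)
      (hrest : GreedySetCover S T (U \ S i) l) : GreedySetCover S T U (i :: l)

end LVED

/-! ### A random access machine with unit cost

Registers and array cells hold natural numbers. The arithmetic is addition and truncated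
subtraction only (no multiplication or division), so that polynomial time with unit cost is the
usual polynomial time. A program is a finite object, so it can name only finitely many registers
and arrays. -/

namespace RAM

/-- A memory state: the register `i` holds `reg i`, the cell `x` of the array `a` holds
`arr a x`. -/
structure State where
  reg : ℕ → ℕ
  arr : ℕ → ℕ → ℕ

/-- Programs; `i`, `j`, `k` are names of registers, `a` is the name of an array. -/
inductive Cmd where
  /-- do nothing -/
  | skip
  /-- `rᵢ := c` for a literal `c` -/
  | const (i c : ℕ)
  /-- `rᵢ := rⱼ` -/
  | move (i j : ℕ)
  /-- `rᵢ := rⱼ + rₖ` -/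
  | add (i j k : ℕ)
  /-- `rᵢ := rⱼ - rₖ`, truncated at `0` -/
  | sub (i j k : ℕ)
  /-- `rᵢ := a[rⱼ]` -/
  | load (i a j : ℕ)
  /-- `a[rᵢ] := rⱼ` -/
  | store (a i j : ℕ)
  /-- first `c`, then `d` -/
  | seq (c d : Cmd)
  /-- if `rᵢ ≠ 0` then `c` else `d` -/
  | cond (i : ℕ) (c d : Cmd)
  /-- while `rᵢ ≠ 0` do `c` -/
  | loop (i : ℕ) (c : Cmd)

/-- The state after `rᵢ := x`. -/
def State.setReg (s : State) (i x : ℕ) : State :=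
  { s with reg := Function.update s.reg i x }

/-- The state after `a[x] := y`. -/
def State.setArr (s : State) (a x y : ℕ) : State :=
  { s with arr := Function.update s.arr a (Function.update (s.arr a) x y) }

/-- `Exec c s t s'`: the program `c`, started in the state `s`, halts after exactly `t` steps in the
state `s'`. Each elementary instruction and each test takes one step. -/
inductive Exec : Cmd → State → ℕ → State → Prop
  | skip (s : State) : Exec .skip s 1 s
  | const (s : State) (i c : ℕ) : Exec (.const i c) s 1 (s.setReg i c)
  | move (s : State) (i j : ℕ) : Exec (.move i j) s 1 (s.setReg i (s.reg j))
  | add (s : State) (i j k : ℕ) : Exec (.add i j k) s 1 (s.setReg i (s.reg j + s.reg k))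
  | sub (s : State) (i j k : ℕ) : Exec (.sub i j k) s 1 (s.setReg i (s.reg j - s.reg k))
  | load (s : State) (i a j : ℕ) : Exec (.load i a j) s 1 (s.setReg i (s.arr a (s.reg j)))
  | store (s : State) (a i j : ℕ) : Exec (.store a i j) s 1 (s.setArr a (s.reg i) (s.reg j))
  | seq {c d : Cmd} {s s' s'' : State} {t t' : ℕ} (h : Exec c s t s') (h' : Exec d s' t' s'') :
      Exec (.seq c d) s (t + t') s''
  | condTrue {i : ℕ} {c d : Cmd} {s s' : State} {t : ℕ} (hi : s.reg i ≠ 0) (h : Exec c s t s') :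
      Exec (.cond i c d) s (t + 1) s'
  | condFalse {i : ℕ} {c d : Cmd} {s s' : State} {t : ℕ} (hi : s.reg i = 0) (h : Exec d s t s') :
      Exec (.cond i c d) s (t + 1) s'
  | loopTrue {i : ℕ} {c : Cmd} {s s' s'' : State} {t t' : ℕ} (hi : s.reg i ≠ 0)
      (h : Exec c s t s') (h' : Exec (.loop i c) s' t' s'') :
      Exec (.loop i c) s (t + t' + 1) s''
  | loopFalse {i : ℕ} {c : Cmd} {s : State} (hi : s.reg i = 0) : Exec (.loop i c) s 1 s

/-- The initial state for an input graph `G` with the vertices `0, …, n - 1`: the register `0` holds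
`n`, the array `0` holds the adjacency matrix of `G`, row by row, and everything else is `0`. -/
def inputState {n : ℕ} (G : SimpleGraph (Fin n)) [DecidableRel G.Adj] : State where
  reg i := if i = 0 then n else 0
  arr a x := if a = 0 ∧ ∃ u v : Fin n, x = u.val * n + v.val ∧ G.Adj u v then 1 else 0

/-- The set of vertices in `{0, …, n - 1}` that is stored, by its indicator vector, in the
array `1`. -/
def State.vertexSet (s : State) (n : ℕ) : Finset (Fin n) :=
  Finset.univ.filter fun v => s.arr 1 v.val = 1

end RAM

/-! Both phases are the same greedy algorithm for multicover without repetition: every `x ∈ X` must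
meet the chosen set in at least `r` points of `N x`, and each step adds a vertex that serves the
most elements of unmet demand. Phase 1 takes the edges with `r = 2` and starts from `∅`. Phase 2
takes the pairs of edges with `r = 3` and starts from `D`. As `D` is 2-ve dominating, every pair
lacks at most one point, so phase 2 is ordinary greedy set cover (`GreedyRun.greedySetCover`).

Dual fitting (`GreedyRun.exists_dual`) bounds the number of greedy choices by the sum, over the
vertices of any feasible `M` outside the start set, of the harmonic numbers of their initial gains
(`GreedyRun.length_le`). The gains are at most `Δ ^ 2` in phase 1 (`card_edges_near_le`) and `Δ ^ 4`
in phase 2 (`card_pairsCoveredBy_le`). A liar's ve-dominating set is feasible for both problems, so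
the two costs add up to `(2 ln Δ + 1) + (4 ln Δ + 1) = 2 (3 ln Δ + 1)` times its size.

For the running time, gains are written as nested sums over vertices in a small expression language
whose compiler is correct and polynomial (`Expr.exec_compile`). The greedy program makes `n` passes
over the vertices, taking each vertex whose gain is currently maximal and positive; an empty pass
means that the run is complete (`exec_greedyCmd`). -/

namespace RAM

/-! ### Expressions and their compilation to the machine -/

/-- Arithmetic expressions over the memory of the machine; `sum v e` is the sum of `e` over the
values `v < r₀` of the variable (that is, register) `v`. -/
inductive Expr where
  | const (c : ℕ)
  | var (i : ℕ)
  | arr (a : ℕ) (e : Expr)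
  | add (e f : Expr)
  | sub (e f : Expr)
  | sum (v : ℕ) (e : Expr)

namespace Expr

/-- The value of an expression. -/
def eval : Expr → State → ℕ
  | const c, _ => c
  | var i, s => s.reg i
  | arr a e, s => s.arr a (e.eval s)
  | add e f, s => e.eval s + f.eval s
  | sub e f, s => e.eval s - f.eval s
  | sum v e, s => ∑ x ∈ Finset.range (s.reg 0), e.eval (s.setReg v x)

/-- All variables of the expression are below `b`, and `0` is not bound. -/
def ok (b : ℕ) : Expr → Bool
  | const _ => true
  | var i => decide (i < b)
  | arr _ e => e.ok b
  | add e f => e.ok b && f.ok b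
  | sub e f => e.ok b && f.ok b
  | sum v e => decide (0 < v) && decide (v < b) && e.ok b

end Expr

/-- Run `c` with the values `r₀ - 1, …, 0` of the register `v`; `o` is an auxiliary register. -/
def forCmd (v o : ℕ) (c : Cmd) : Cmd :=
  .seq (.move v 0) (.loop v (.seq (.seq (.const o 1) (.sub v v o)) c))

/-- The program that computes an expression into the register `b`, using the registers from `b`
on as work space. -/
def Expr.compile : Expr → ℕ → Cmd
  | .const c, b => .const b c
  | .var i, b => .move b i
  | .arr a e, b => .seq (e.compile b) (.load b a b)
  | .add e f, b => .seq (.seq (e.compile b) (f.compile (b + 1))) (.add b b (b + 1))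
  | .sub e f, b => .seq (.seq (e.compile b) (f.compile (b + 1))) (.sub b b (b + 1))
  | .sum v e, b =>
      .seq (.seq (.seq (.const b 0) (.move (b + 1) v))
        (forCmd v (b + 2) (.seq (e.compile (b + 2)) (.add b b (b + 2))))) (.move v (b + 1))

/-- A bound for the number of steps of the compiled expression. -/
noncomputable def Expr.cost : Expr → Polynomial ℕ
  | .const _ => 1
  | .var _ => 1
  | .arr _ e => e.cost + 1
  | .add e f => e.cost + f.cost + 1
  | .sub e f => e.cost + f.cost + 1
  | .sum _ e => Polynomial.X * (e.cost + 4) + 5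

namespace State

@[simp] theorem reg_setReg (s : State) (i x j : ℕ) :
    (s.setReg i x).reg j = if j = i then x else s.reg j := by
  simp [setReg, Function.update_apply]

@[simp] theorem arr_setReg (s : State) (i x : ℕ) : (s.setReg i x).arr = s.arr := rfl

@[simp] theorem reg_setArr (s : State) (a x y : ℕ) : (s.setArr a x y).reg = s.reg := rfl

theorem arr_setArr (s : State) (a x y b z : ℕ) :
    (s.setArr a x y).arr b z = if b = a ∧ z = x then y else s.arr b z := by
  by_cases hb : b = a
  · subst hb; simp [setArr, Function.update_apply]
  · simp [setArr, hb]

end State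

/-- `I k` is the invariant when the values below `k` remain to be processed. The body may destroy
`o`, because the constant 1 is reloaded in every round, but it must preserve the counter `v`. The 3
extra steps per round are the test, the constant and the subtraction. -/
theorem exec_loop_countdown {v o : ℕ} {c : Cmd} {T : ℕ} (I : ℕ → State → Prop) (ho : o ≠ v)
    (n : ℕ)
    (hstep : ∀ k < n, ∀ s, I (k + 1) s → ∃ t s', Exec c ((s.setReg o 1).setReg v k) t s' ∧
      t ≤ T ∧ I k s' ∧ s'.reg v = k) :
    ∀ s, s.reg v = n → I n s →
      ∃ t s', Exec (.loop v (.seq (.seq (.const o 1) (.sub v v o)) c)) s t s' ∧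
        t ≤ n * (T + 3) + 1 ∧ I 0 s' := by
  induction n with
  | zero => exact fun s hs hI => ⟨1, s, .loopFalse hs, by simp, hI⟩
  | succ n ih =>
    intro s hs hI
    obtain ⟨t, s', hex, ht, hI', hv⟩ := hstep n (Nat.lt_succ_self n) s hI
    obtain ⟨t', s'', hex', ht', hI''⟩ := ih (fun k hk => hstep k (hk.trans n.lt_succ_self)) s' hv hI'
    have h2 := Exec.sub (s.setReg o 1) v v o
    have e : (s.setReg o 1).reg v - (s.setReg o 1).reg o = n := by simp [ho.symm, hs]
    rw [e] at h2
    refine ⟨_, s'', .loopTrue (by omega) (.seq (.seq (.const s o 1) h2) hex) hex', ?_, hI''⟩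
    rw [Nat.succ_mul]
    omega

theorem exec_forCmd {v o : ℕ} {c : Cmd} {T : ℕ} (I : ℕ → State → Prop) (ho : o ≠ v) (s : State)
    (hI : I (s.reg 0) (s.setReg v (s.reg 0)))
    (hstep : ∀ k < s.reg 0, ∀ s', I (k + 1) s' → ∃ t s'',
      Exec c ((s'.setReg o 1).setReg v k) t s'' ∧ t ≤ T ∧ I k s'' ∧ s''.reg v = k) :
    ∃ t s', Exec (forCmd v o c) s t s' ∧ t ≤ s.reg 0 * (T + 3) + 2 ∧ I 0 s' := by
  obtain ⟨t, s', hex, ht, hI'⟩ := exec_loop_countdown I ho (s.reg 0) hstep _ (by simp) hI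
  exact ⟨_, s', .seq (.move s v 0) hex, by omega, hI'⟩

namespace Expr

theorem ok_mono {b b' : ℕ} (h : b ≤ b') : ∀ {e : Expr}, e.ok b → e.ok b'
  | const _, _ => rfl
  | var i, he => by simp only [ok, decide_eq_true_eq] at he ⊢; omega
  | arr _ e, he => ok_mono (e := e) h he
  | add e f, he => by
      simp only [ok, Bool.and_eq_true] at he ⊢
      exact ⟨ok_mono h he.1, ok_mono h he.2⟩
  | sub e f, he => by
      simp only [ok, Bool.and_eq_true] at he ⊢
      exact ⟨ok_mono h he.1, ok_mono h he.2⟩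
  | sum v e, he => by
      simp only [ok, Bool.and_eq_true, decide_eq_true_eq] at he ⊢
      exact ⟨⟨he.1.1, by omega⟩, ok_mono h he.2⟩

/-- An operand keeps its value while the work registers from `b` on are overwritten. -/
theorem eval_congr {b : ℕ} (hb : 0 < b) : ∀ {e : Expr}, e.ok b → ∀ {s s' : State},
    s'.arr = s.arr → (∀ i < b, s'.reg i = s.reg i) → e.eval s' = e.eval s
  | const _, _, _, _, _, _ => rfl
  | var i, he, _, _, _, hr => hr i (by simpa [ok] using he)
  | arr a e, he, _, _, ha, hr => by
      simp only [eval]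
      rw [ha, eval_congr hb (e := e) he ha hr]
  | add e f, he, _, _, ha, hr => by
      simp only [ok, Bool.and_eq_true] at he
      simp only [eval]
      rw [eval_congr hb he.1 ha hr, eval_congr hb he.2 ha hr]
  | sub e f, he, _, _, ha, hr => by
      simp only [ok, Bool.and_eq_true] at he
      simp only [eval]
      rw [eval_congr hb he.1 ha hr, eval_congr hb he.2 ha hr]
  | sum v e, he, s, s', ha, hr => by
      simp only [ok, Bool.and_eq_true, decide_eq_true_eq] at he
      simp only [eval]
      rw [hr 0 hb]
      refine Finset.sum_congr rfl fun x _ => eval_congr hb he.2 (by simpa using ha) fun i hi => ?_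
      simp [hr i hi]

/-- The compiled expression computes the expression in polynomial time, and changes nothing but
the registers from `b` on. -/
theorem exec_compile : ∀ (e : Expr) (b : ℕ) (s : State), 0 < b → e.ok b →
    ∃ t s', Exec (e.compile b) s t s' ∧ t ≤ e.cost.eval (s.reg 0) ∧ s'.reg b = e.eval s ∧
      (∀ i < b, s'.reg i = s.reg i) ∧ s'.arr = s.arr
  | const c, b, s, _, _ => ⟨1, _, .const s b c, by simp [cost], by simp [eval],
      fun i hi => by simp [hi.ne], rfl⟩
  | var i, b, s, _, _ => ⟨1, _, .move s b i, by simp [cost], by simp [eval],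
      fun i hi => by simp [hi.ne], rfl⟩
  | arr a e, b, s, hb, he => by
      obtain ⟨t, s', hex, ht, hv, hr, ha⟩ := exec_compile e b s hb he
      refine ⟨_, _, .seq hex (.load s' b a b), by simp [cost, ht], by simp [eval, ha, hv],
        fun i hi => by simp [hi.ne, hr i hi], by simpa using ha⟩
  | add e f, b, s, hb, he => by
      simp only [ok, Bool.and_eq_true] at he
      obtain ⟨t, s', hex, ht, hv, hr, ha⟩ := exec_compile e b s hb he.1
      obtain ⟨t', s'', hex', ht', hv', hr', ha'⟩ :=
        exec_compile f (b + 1) s' (by omega) (ok_mono (by omega) he.2)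
      refine ⟨_, _, .seq (.seq hex hex') (.add s'' b b (b + 1)), ?_, ?_, fun i hi => ?_, ?_⟩
      · rw [hr 0 hb] at ht'
        simp [cost]; omega
      · simp [eval, hv', hr' b (by omega), hv, eval_congr hb he.2 ha hr]
      · simp [hi.ne, hr' i (by omega), hr i hi]
      · simp [ha', ha]
  | sub e f, b, s, hb, he => by
      simp only [ok, Bool.and_eq_true] at he
      obtain ⟨t, s', hex, ht, hv, hr, ha⟩ := exec_compile e b s hb he.1
      obtain ⟨t', s'', hex', ht', hv', hr', ha'⟩ :=
        exec_compile f (b + 1) s' (by omega) (ok_mono (by omega) he.2)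
      refine ⟨_, _, .seq (.seq hex hex') (.sub s'' b b (b + 1)), ?_, ?_, fun i hi => ?_, ?_⟩
      · rw [hr 0 hb] at ht'
        simp [cost]; omega
      · simp [eval, hv', hr' b (by omega), hv, eval_congr hb he.2 ha hr]
      · simp [hi.ne, hr' i (by omega), hr i hi]
      · simp [ha', ha]
  | sum v e, b, s, hb, he => by
      simp only [ok, Bool.and_eq_true, decide_eq_true_eq] at he
      obtain ⟨⟨hv0, hvb⟩, he⟩ := he
      set s₀ : State := (s.setReg b 0).setReg (b + 1) (s.reg v) with hs₀
      have hs₀0 : s₀.reg 0 = s.reg 0 := by simp [hs₀, hb.ne]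
      have hinit : Exec (.seq (.const b 0) (.move (b + 1) v)) s (1 + 1) s₀ := by
        have h := Exec.move (s.setReg b 0) (b + 1) v
        rw [show (s.setReg b 0).reg v = s.reg v by simp [hvb.ne]] at h
        exact .seq (.const s b 0) h
      -- Register `b` accumulates and `b + 1` saves the old value of `v`. Since the loop counts
      -- down, the terms still missing from the accumulator are those with index below `k`.
      let I : ℕ → State → Prop := fun k s' => s'.arr = s.arr ∧
        (∀ i < b, i ≠ v → s'.reg i = s.reg i) ∧ s'.reg (b + 1) = s.reg v ∧
        s'.reg b + ∑ x ∈ Finset.range k, e.eval (s.setReg v x) = (sum v e).eval s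
      obtain ⟨t, s', hex, ht, ha, hr, hsv, hsum⟩ := exec_forCmd (v := v) (o := b + 2)
        (c := .seq (e.compile (b + 2)) (.add b b (b + 2))) (T := e.cost.eval (s.reg 0) + 1)
        I (by omega) s₀
        ⟨by simp [hs₀], fun i hi hiv => by
            simp [hs₀, hiv, hi.ne, show i ≠ b + 1 by omega],
          by simp [hs₀, show b + 1 ≠ v by omega],
          by simp [hs₀, eval, show b ≠ v by omega, hb.ne]⟩ (by
        rintro k - s' ⟨ha, hr, hsv, hsum⟩
        obtain ⟨t', s'', hex', ht', hv', hr', ha'⟩ := exec_compile e (b + 2)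
          ((s'.setReg (b + 2) 1).setReg v k) (by omega) (ok_mono (by omega) he)
        have h0 : ((s'.setReg (b + 2) 1).setReg v k).reg 0 = s.reg 0 := by
          simp [hv0.ne, hr 0 hb hv0.ne]
        rw [h0] at ht'
        have heq : e.eval ((s'.setReg (b + 2) 1).setReg v k) = e.eval (s.setReg v k) :=
          eval_congr hb he (by simp [ha]) fun i hi => by
            by_cases hiv : i = v
            · simp [hiv]
            · simp [hiv, show i ≠ b + 2 by omega, hr i hi hiv]
        refine ⟨_, _, .seq hex' (.add s'' b b (b + 2)), by omega, ⟨?_, fun i hi hiv => ?_, ?_, ?_⟩,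
          ?_⟩
        · simp [ha', ha]
        · simp [hi.ne, hr' i (by omega), hiv, show i ≠ b + 2 by omega, hr i hi hiv]
        · simp [hr' (b + 1) (by omega), show b + 1 ≠ v by omega, hsv]
        · rw [Finset.sum_range_succ] at hsum
          simp only [State.reg_setReg, if_true, hv', heq, hr' b (by omega),
            show b ≠ v by omega, show b ≠ b + 2 by omega, if_false]
          omega
        · simp [hvb.ne, hr' v (by omega)])
      refine ⟨_, _, .seq (.seq hinit hex) (.move s' v (b + 1)), ?_, ?_, fun i hi => ?_, ?_⟩
      · rw [hs₀0] at ht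
        simp only [cost, Polynomial.eval_add, Polynomial.eval_mul, Polynomial.eval_X,
          Polynomial.eval_ofNat]
        have : e.cost.eval (s.reg 0) + 1 + 3 = e.cost.eval (s.reg 0) + 4 := rfl
        rw [this] at ht
        omega
      · simpa [show b ≠ v by omega] using hsum
      · by_cases hiv : i = v
        · simp [hiv, hsv]
        · simp [hiv, hr i hi hiv]
      · simp [ha]

/-- Negation; an expression is read as true if its value is not `0`. -/
def not (e : Expr) : Expr := .sub (.const 1) e

/-- Conjunction. -/
def and (e f : Expr) : Expr := .not (.add e.not f.not)

/-- Disjunction. -/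
def or (e f : Expr) : Expr := .not (.not (.add e f))

/-- The expression for `e < f`. -/
def lt (e f : Expr) : Expr := .sub f e

/-- The expression for `e = f`. -/
def eq (e f : Expr) : Expr := .not (.add (.sub e f) (.sub f e))

@[simp] theorem eval_not (e : Expr) (s : State) :
    e.not.eval s = if e.eval s = 0 then 1 else 0 := by
  simp only [not, eval]; split_ifs <;> omega

@[simp] theorem eval_and (e f : Expr) (s : State) :
    (e.and f).eval s = if e.eval s ≠ 0 ∧ f.eval s ≠ 0 then 1 else 0 := by
  simp only [and, eval_not, eval]; split_ifs <;> omega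

@[simp] theorem eval_or (e f : Expr) (s : State) :
    (e.or f).eval s = if e.eval s ≠ 0 ∨ f.eval s ≠ 0 then 1 else 0 := by
  by_cases he : e.eval s = 0 <;> by_cases hf : f.eval s = 0 <;> simp [or, eval, he, hf]

theorem eval_lt_ne_zero (e f : Expr) (s : State) :
    (e.lt f).eval s ≠ 0 ↔ e.eval s < f.eval s := by
  simp only [lt, eval]; omega

theorem eval_eq_ne_zero (e f : Expr) (s : State) :
    (e.eq f).eval s ≠ 0 ↔ e.eval s = f.eval s := by
  by_cases h : e.eval s = f.eval s
  · simp [eq, eval, h]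
  · simp [eq, eval, h]
    omega

end Expr

end RAM

/-! ### Greedy multicover and dual fitting -/

namespace LVED

section Greedy

variable {V α : Type*} [DecidableEq V]

/-- The number of the `x ∈ X` that `L` meets in less than `r` points of `N x` and that `v ∉ L`
helps to cover. -/
def gain (X : Finset α) (N : α → Finset V) (r : ℕ) (L : Finset V) (v : V) : ℕ :=
  (X.filter fun x => (v ∉ L ∧ v ∈ N x) ∧ (N x ∩ L).card < r).card

/-- A run of the greedy algorithm for the multicover problem, from the set `L` to the set `L'`,
that chooses the elements of a list in this order. -/
inductive GreedyRun (X : Finset α) (N : α → Finset V) (r : ℕ) :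
    Finset V → List V → Finset V → Prop
  | nil (L : Finset V) : GreedyRun X N r L [] L
  | cons {L L' : Finset V} {v : V} {l : List V} (hpos : gain X N r L v ≠ 0)
      (hmax : ∀ u, gain X N r L u ≤ gain X N r L v) (h : GreedyRun X N r (insert v L) l L') :
      GreedyRun X N r L (v :: l) L'

variable {X : Finset α} {N : α → Finset V} {r : ℕ}

theorem notMem_of_gain_ne_zero {L : Finset V} {v : V} (h : gain X N r L v ≠ 0) : v ∉ L := by
  intro hv
  apply h
  simp [gain, hv]

theorem card_inter_mono (A : Finset V) {L L' : Finset V} (h : L ⊆ L') :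
    (A ∩ L).card ≤ (A ∩ L').card :=
  Finset.card_le_card (Finset.inter_subset_inter_left h)

/-- Diminishing returns: the price `1 / gain` paid per covered unit never decreases along a greedy
run, and a completed run stays completed. -/
theorem gain_anti {L L' : Finset V} (h : L ⊆ L') (v : V) : gain X N r L' v ≤ gain X N r L v := by
  refine Finset.card_le_card fun x => ?_
  simp only [Finset.mem_filter]
  rintro ⟨hx, ⟨hv, hvx⟩, hc⟩
  exact ⟨hx, ⟨fun hvL => hv (h hvL), hvx⟩, (card_inter_mono _ h).trans_lt hc⟩

namespace GreedyRun

theorem trans {L₁ L₂ L₃ : Finset V} {l l' : List V} (h : GreedyRun X N r L₁ l L₂)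
    (h' : GreedyRun X N r L₂ l' L₃) : GreedyRun X N r L₁ (l ++ l') L₃ := by
  induction h with
  | nil => exact h'
  | cons hpos hmax _ ih => exact .cons hpos hmax (ih h')

theorem eq_union {L L' : Finset V} {l : List V} (h : GreedyRun X N r L l L') :
    L' = L ∪ l.toFinset := by
  induction h with
  | nil => simp
  | cons _ _ _ ih => rw [ih]; ext; simp

theorem card_eq {L L' : Finset V} {l : List V} (h : GreedyRun X N r L l L') :
    L'.card = L.card + l.length := by
  induction h with
  | nil => simp
  | cons hpos _ _ ih =>
    rw [ih, Finset.card_insert_of_notMem (notMem_of_gain_ne_zero hpos), List.length_cons]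
    omega

end GreedyRun

/-- Each of the `a - b` terms by which the two harmonic numbers differ is at least `1 / k`. -/
theorem harmonic_sub_le {a b k : ℕ} (hba : b ≤ a) (hak : a ≤ k) :
    (harmonic b : ℝ) + ((a : ℝ) - b) / k ≤ harmonic a := by
  induction a, hba using Nat.le_induction with
  | base => simp
  | succ a hba ih =>
    have := ih (by omega)
    rw [harmonic_succ]
    push_cast
    have hk : ((k : ℝ))⁻¹ ≤ ((a : ℝ) + 1)⁻¹ := by
      apply inv_anti₀ (by positivity)
      exact_mod_cast hak
    have : ((a : ℝ) + 1 - b) / k = (a - b) / k + (k : ℝ)⁻¹ := by ring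
    linarith

theorem card_inter_insert {A L : Finset V} {v : V} (hv : v ∉ L) (hA : v ∈ A) :
    (A ∩ insert v L).card = (A ∩ L).card + 1 := by
  rw [Finset.inter_insert_of_mem hA, Finset.card_insert_of_notMem (by simp [hv])]

open Finset in
/-- Dual fitting: values of the dual variables of the multicover problem that pay for a complete
run of the greedy algorithm and that are feasible up to harmonic numbers. -/
theorem GreedyRun.exists_dual [DecidableEq α] {L L' : Finset V} {l : List V} (h : GreedyRun X N r L l L')
    [Fintype V] (hfin : ∀ x ∈ X, r ≤ (N x ∩ L').card) :
    ∃ (y : α → ℝ) (z : V → ℝ), (∀ u, 0 ≤ z u) ∧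
      (∀ k : ℕ, (∀ u, gain X N r L u ≤ k) → ∀ x ∈ X, (N x ∩ L).card < r → (k : ℝ)⁻¹ ≤ y x) ∧
      ((l.length : ℝ) ≤ ∑ x ∈ X, ((r - (N x ∩ L).card : ℕ) : ℝ) * y x - ∑ u, z u) ∧
      ∀ u, u ∉ L →
        (∑ x ∈ X with (u ∉ L ∧ u ∈ N x) ∧ (N x ∩ L).card < r, y x) - z u ≤
          harmonic (gain X N r L u) := by
  induction h with
  | nil L =>
    refine ⟨0, 0, by simp, fun k _ x hx hc => absurd (hfin x hx) (by omega), by simp, ?_⟩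
    intro u _
    have : (0 : ℚ) ≤ harmonic (gain X N r L u) := Finset.sum_nonneg fun i _ => by positivity
    simpa using (by exact_mod_cast this : (0 : ℝ) ≤ harmonic (gain X N r L u))
  | @cons L L' v l hpos hmax h ih =>
    obtain ⟨y', z', hz', hy', hlen', hcon'⟩ := ih hfin
    have hv := notMem_of_gain_ne_zero hpos
    set k := gain X N r L v with hk
    have hk0 : (0 : ℝ) < k := by exact_mod_cast Nat.pos_of_ne_zero hpos
    -- The dual price of `x` is the price at which its last unit of demand is met, so an `x` still
    -- unsatisfied after `v` keeps its later price.
    set y : α → ℝ := fun x => if (N x ∩ insert v L).card < r then y' x else (k : ℝ)⁻¹ with hy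
    have hyk : ∀ x ∈ X, (k : ℝ)⁻¹ ≤ y x := by
      intro x hx
      by_cases hc : (N x ∩ insert v L).card < r
      · simp only [hy, hc, if_true]
        exact hy' k (fun u => (gain_anti (subset_insert v L) u).trans (hmax u)) x hx hc
      · simp [hy, hc]
    set A : V → Finset α := fun u => X.filter fun x => (u ∉ L ∧ u ∈ N x) ∧ (N x ∩ L).card < r
      with hA
    have hcardA : ∀ u, (A u).card = gain X N r L u := fun u => rfl
    have hsumA : ∑ x ∈ A v, (y x - (k : ℝ)⁻¹) = ∑ x ∈ A v, y x - 1 := by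
      rw [sum_sub_distrib, sum_const, hcardA, nsmul_eq_mul, ← hk, mul_inv_cancel₀ hk0.ne']
    have hzv : 0 ≤ ∑ x ∈ A v, (y x - (k : ℝ)⁻¹) :=
      sum_nonneg fun x hx => sub_nonneg.2 (hyk x (mem_filter.1 hx).1)
    refine ⟨y, Function.update z' v (∑ x ∈ A v, (y x - (k : ℝ)⁻¹)), ?_, ?_, ?_, ?_⟩
    · intro u
      by_cases huv : u = v
      · subst huv; simpa using hzv
      · simpa [huv] using hz' u
    · intro k₂ hk₂ x hx _
      exact (inv_anti₀ hk0 (by exact_mod_cast hk₂ v)).trans (hyk x hx)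
    -- Adding `v` lowers the residual demand by one exactly on `A v`. Together with the refund, the
    -- dual value grows by at least the cost 1 of `v`.
    · have hpt : ∀ x ∈ X, ((r - (N x ∩ L).card : ℕ) : ℝ) * y x =
          ((r - (N x ∩ insert v L).card : ℕ) : ℝ) * y' x +
            if (v ∉ L ∧ v ∈ N x) ∧ (N x ∩ L).card < r then y x else 0 := by
        intro x _
        by_cases hvx : v ∈ N x
        · have hc := card_inter_insert hv hvx
          by_cases hcr : (N x ∩ L).card < r
          · rw [if_pos ⟨⟨hv, hvx⟩, hcr⟩]
            obtain ⟨d, hd⟩ : ∃ d, r = (N x ∩ L).card + 1 + d := ⟨r - ((N x ∩ L).card + 1), by omega⟩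
            have e1 : r - (N x ∩ L).card = d + 1 := by omega
            have e2 : r - (N x ∩ insert v L).card = d := by omega
            rw [e1, e2]
            rcases Nat.eq_zero_or_pos d with rfl | hd0
            · simp
            · have : (N x ∩ insert v L).card < r := by omega
              simp only [hy, this, if_true]
              push_cast; ring
          · have e1 : r - (N x ∩ L).card = 0 := by omega
            have e2 : r - (N x ∩ insert v L).card = 0 := by omega
            simp [e1, e2, hcr]
        · rw [inter_insert_of_notMem hvx]
          by_cases hcr : (N x ∩ L).card < r
          · simp [hy, inter_insert_of_notMem hvx, hcr, hvx]
          · have e1 : r - (N x ∩ L).card = 0 := by omega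
            simp [e1, hcr]
      rw [sum_congr rfl hpt, sum_add_distrib, ← sum_filter, sum_update_of_mem (mem_univ v), hsumA]
      have h1 : ∑ u, z' u = z' v + ∑ u ∈ univ \ {v}, z' u := by
        rw [sdiff_singleton_eq_erase, add_sum_erase _ _ (mem_univ v)]
      have := hz' v
      push_cast [List.length_cons]
      change _ ≤ _ + ∑ x ∈ A v, y x - _
      linarith
    · intro u hu
      by_cases huv : u = v
      · subst huv
        -- For the chosen vertex the left side is exactly 1, and `1 ≤ harmonic k` as `k > 0`.
        have h1 := harmonic_sub_le (Nat.zero_le k) le_rfl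
        simp only [harmonic_zero, Nat.cast_zero, sub_zero, div_self hk0.ne', Rat.cast_zero,
          zero_add] at h1
        rw [Function.update_self, hsumA]
        change ∑ x ∈ A u, y x - _ ≤ _
        linarith
      · rw [Function.update_of_ne huv]
        have h1 := hcon' u (by simp [huv, hu])
        have h2 := harmonic_sub_le (gain_anti (X := X) (N := N) (r := r) (subset_insert v L) u)
          (hmax u)
        set B := X.filter fun x => (u ∉ insert v L ∧ u ∈ N x) ∧ (N x ∩ insert v L).card < r with hB
        have hBA : B ⊆ A u := by
          intro x
          simp only [hB, hA, mem_filter]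
          rintro ⟨hx, ⟨_, hux⟩, hc⟩
          exact ⟨hx, ⟨hu, hux⟩, (card_inter_mono _ (subset_insert v L)).trans_lt hc⟩
        have h3 : ∑ x ∈ B, y x = ∑ x ∈ B, y' x := sum_congr rfl fun x hx => by
          simp [hy, (mem_filter.1 hx).2.2]
        -- The elements that drop out of the gain of `u` were satisfied by `v` at price `1 / k`. By
        -- `h2` the drop in the harmonic number pays for them, as greediness makes the gain of `u`
        -- at most `k`.
        have h4 : ∑ x ∈ A u \ B, y x = ((A u).card - B.card : ℝ) / k := by
          have : ∀ x ∈ A u \ B, y x = (k : ℝ)⁻¹ := by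
            intro x hx
            have hxA := mem_filter.1 (mem_sdiff.1 hx).1
            have : ¬ (N x ∩ insert v L).card < r := fun hc =>
              (mem_sdiff.1 hx).2 (mem_filter.2 ⟨hxA.1, ⟨by simp [huv, hu], hxA.2.1.2⟩, hc⟩)
            simp [hy, this]
          rw [sum_congr rfl this, sum_const, nsmul_eq_mul, cast_card_sdiff hBA, div_eq_mul_inv]
        have h5 : ∑ x ∈ A u, y x = ∑ x ∈ A u \ B, y x + ∑ x ∈ B, y x := (sum_sdiff hBA).symm
        change ∑ x ∈ A u, y x - _ ≤ _
        rw [h5, h3, h4]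
        have hBc : B.card = gain X N r (insert v L) u := rfl
        rw [hcardA, hBc]
        linarith

open Finset in
/-- The greedy algorithm for the multicover problem is within a harmonic factor of the optimum. -/
theorem GreedyRun.length_le {L L' M : Finset V} {l : List V} (h : GreedyRun X N r L l L')
    [Fintype V] (hfin : ∀ x ∈ X, r ≤ (N x ∩ L').card) (hM : ∀ x ∈ X, r ≤ (N x ∩ M).card) :
    (l.length : ℝ) ≤ ∑ u ∈ M \ L, (harmonic (gain X N r L u) : ℝ) := by
  classical
  obtain ⟨y, z, hz, hy, hlen, hcon⟩ := h.exists_dual hfin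
  have hpt : ∀ x ∈ X, ((r - (N x ∩ L).card : ℕ) : ℝ) * y x ≤
      ∑ u ∈ M \ L, if (u ∉ L ∧ u ∈ N x) ∧ (N x ∩ L).card < r then y x else 0 := by
    intro x hx
    by_cases hc : (N x ∩ L).card < r
    · have hyx : 0 ≤ y x :=
        -- Any common upper bound for the gains gives nonnegativity of the price; the sum of all
        -- gains is one.
        le_trans (by positivity) (hy _ (fun u => single_le_sum (f := gain X N r L)
          (fun _ _ => Nat.zero_le _) (mem_univ u)) x hx hc)
      rw [← sum_filter, sum_const, nsmul_eq_mul]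
      refine mul_le_mul_of_nonneg_right ?_ hyx
      -- Weak duality: the residual demand of `x` must be met by points of `M \ L`.
      have hsub : N x ∩ M ⊆ (N x ∩ L) ∪
          (M \ L).filter fun u => (u ∉ L ∧ u ∈ N x) ∧ (N x ∩ L).card < r := by
        intro u
        simp only [mem_inter, mem_union, mem_filter, mem_sdiff]
        tauto
      have := (hM x hx).trans ((card_le_card hsub).trans (card_union_le _ _))
      exact_mod_cast (by omega)
    · simp [show r - (N x ∩ L).card = 0 by omega, hc]
  have h1 := sum_le_sum hpt
  rw [sum_comm] at h1
  simp only [← sum_filter] at h1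
  have h2 : ∑ u ∈ M \ L, z u ≤ ∑ u, z u :=
    sum_le_sum_of_subset_of_nonneg (subset_univ _) fun u _ _ => hz u
  have h3 := sum_le_sum fun u (hu : u ∈ M \ L) => hcon u (mem_sdiff.1 hu).2
  rw [sum_sub_distrib] at h3
  linarith

theorem GreedyRun.length_le_mul_log {L L' M : Finset V} {l : List V}
    (h : GreedyRun X N r L l L') [Fintype V] (hfin : ∀ x ∈ X, r ≤ (N x ∩ L').card)
    (hM : ∀ x ∈ X, r ≤ (N x ∩ M).card) {m p : ℕ} (hm : ∀ u ∉ L, gain X N r L u ≤ m ^ p) :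
    (l.length : ℝ) ≤ (p * Real.log m + 1) * M.card := by
  have hb : ∀ u ∈ M \ L, (harmonic (gain X N r L u) : ℝ) ≤ p * Real.log m + 1 := by
    intro u hu
    have h1 : harmonic (gain X N r L u) ≤ harmonic (m ^ p) :=
      Finset.sum_le_sum_of_subset_of_nonneg
        (Finset.range_mono (hm u (Finset.mem_sdiff.1 hu).2)) fun i _ _ => by positivity
    have h2 := harmonic_le_one_add_log (m ^ p)
    rw [Nat.cast_pow, Real.log_pow] at h2
    have h1' : (harmonic (gain X N r L u) : ℝ) ≤ harmonic (m ^ p) := by exact_mod_cast h1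
    linarith
  refine (h.length_le hfin hM).trans ((Finset.sum_le_card_nsmul _ _ _ hb).trans ?_)
  rw [nsmul_eq_mul, mul_comm]
  have h0 : 0 ≤ p * Real.log m + 1 := by
    have := Real.log_natCast_nonneg m
    positivity
  refine mul_le_mul_of_nonneg_left ?_ h0
  exact_mod_cast Finset.card_le_card Finset.sdiff_subset

/-- An unsatisfied `x` has a point of `N x` outside `L`, because `N x` itself is large enough; that
point would have positive gain. -/
theorem covered_of_gain_eq_zero {L : Finset V} (h : ∀ v, gain X N r L v = 0)
    (hN : ∀ x ∈ X, r ≤ (N x).card) : ∀ x ∈ X, r ≤ (N x ∩ L).card := by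
  intro x hx
  by_contra hc
  have hne : ¬ N x ⊆ L := fun hs => hc (by rw [Finset.inter_eq_left.2 hs]; exact hN x hx)
  obtain ⟨v, hv, hvL⟩ := Finset.not_subset.1 hne
  have := h v
  rw [gain, Finset.card_eq_zero, Finset.filter_eq_empty_iff] at this
  exact this hx ⟨⟨hvL, hv⟩, by omega⟩

end Greedy

end LVED

/-! ### Edge neighbourhoods and the degree bounds for the gains -/

namespace LVED

section Bounds

variable {V : Type*} [Fintype V] [DecidableEq V] {G : SimpleGraph V} [DecidableRel G.Adj]

theorem mem_edgeNbhd_mk {x y w : V} :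
    w ∈ edgeNbhd G s(x, y) ↔ (w = x ∨ w = y) ∨ G.Adj x w ∨ G.Adj y w := by
  simp only [edgeNbhd, Finset.mem_filter, Finset.mem_univ, true_and, Sym2.mem_iff]
  constructor
  · rintro ⟨u, rfl | rfl, h⟩ <;> tauto
  · rintro ((h | h) | h | h)
    · exact ⟨x, by simp, .inl h⟩
    · exact ⟨y, by simp, .inl h⟩
    · exact ⟨x, by simp, .inr h⟩
    · exact ⟨y, by simp, .inr h⟩

theorem mem_edgeNbhd_of_mem {e : Sym2 V} {v : V} (h : v ∈ e) : v ∈ edgeNbhd G e :=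
  Finset.mem_filter.2 ⟨Finset.mem_univ _, v, h, .inl rfl⟩

theorem two_le_card_edgeNbhd {e : Sym2 V} (he : e ∈ G.edgeFinset) : 2 ≤ (edgeNbhd G e).card := by
  induction e with | _ x y =>
  have hxy : x ≠ y := (show G.Adj x y by simpa using he).ne
  rw [← Finset.card_pair hxy]
  refine Finset.card_le_card fun w hw => mem_edgeNbhd_of_mem ?_
  simpa using hw

/-- Distinct edges have at least three endpoints in total, so the demand 3 of a pair can always be
met. -/
theorem three_le_card_union_edgeNbhd {e f : Sym2 V} (he : e ∈ G.edgeFinset)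
    (hf : f ∈ G.edgeFinset) (hef : e ≠ f) : 3 ≤ (edgeNbhd G e ∪ edgeNbhd G f).card := by
  induction e with | _ x y =>
  have hxy : x ≠ y := (show G.Adj x y by simpa using he).ne
  obtain ⟨w, hw, hwx, hwy⟩ : ∃ w ∈ f, w ≠ x ∧ w ≠ y := by
    induction f with | _ a b =>
    have hab : a ≠ b := (show G.Adj a b by simpa using hf).ne
    by_contra! hc
    have ha := hc a (by simp)
    have hb := hc b (by simp)
    apply hef
    rw [Sym2.eq_iff]
    by_cases h1 : a = x <;> by_cases h2 : b = x <;> grind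
  have h3 : ({w, x, y} : Finset V).card = 3 := by
    rw [Finset.card_insert_of_notMem (by simp [hwx, hwy]), Finset.card_pair hxy]
  rw [← h3]
  refine Finset.card_le_card fun u hu => Finset.mem_union.2 ?_
  simp only [Finset.mem_insert, Finset.mem_singleton] at hu
  rcases hu with rfl | rfl | rfl
  · exact .inr (mem_edgeNbhd_of_mem hw)
  · exact .inl (mem_edgeNbhd_of_mem (by simp))
  · exact .inl (mem_edgeNbhd_of_mem (by simp))

/-- Such an edge always has an endpoint adjacent to `v`: if `v` is itself an endpoint, the other one
serves. This leaves `Δ` choices for that endpoint and `Δ` for an edge at it. -/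
theorem card_edges_near_le (v : V) :
    (G.edgeFinset.filter fun e => v ∈ edgeNbhd G e).card ≤ G.maxDegree ^ 2 := by
  have hsub : (G.edgeFinset.filter fun e => v ∈ edgeNbhd G e) ⊆
      (G.neighborFinset v).biUnion fun u => G.incidenceFinset u := by
    intro e he
    obtain ⟨he, hv⟩ := Finset.mem_filter.1 he
    induction e with | _ x y =>
    have hxy : G.Adj x y := by simpa using he
    have hm : ∀ u, G.Adj v u → (u = x ∨ u = y) →
        s(x, y) ∈ (G.neighborFinset v).biUnion fun u => G.incidenceFinset u := by
      intro u hvu hu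
      refine Finset.mem_biUnion.2 ⟨u, by simpa using hvu, ?_⟩
      rw [SimpleGraph.mem_incidenceFinset]
      exact ⟨hxy, by simpa using hu⟩
    rcases mem_edgeNbhd_mk.1 hv with (rfl | rfl) | h | h
    · exact hm y hxy (.inr rfl)
    · exact hm x hxy.symm (.inl rfl)
    · exact hm x h.symm (.inl rfl)
    · exact hm y h.symm (.inr rfl)
  refine (Finset.card_le_card hsub).trans ((Finset.card_biUnion_le_card_mul _ _ G.maxDegree
    fun u _ => ?_).trans ?_)
  · rw [G.card_incidenceFinset_eq_degree]
    exact G.degree_le_maxDegree u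
  · rw [sq, G.card_neighborFinset_eq_degree]
    exact Nat.mul_le_mul_right _ (G.degree_le_maxDegree v)

/-- The pairs of edges, as sets. -/
theorem mem_pairs {P : Finset (Sym2 V)} : P ∈ G.edgeFinset.powersetCard 2 ↔
    ∃ e ∈ G.edgeFinset, ∃ f ∈ G.edgeFinset, e ≠ f ∧ P = {e, f} := by
  rw [Finset.mem_powersetCard, Finset.card_eq_two]
  constructor
  · rintro ⟨hs, e, f, hef, rfl⟩
    exact ⟨e, hs (by simp), f, hs (by simp), hef, rfl⟩
  · rintro ⟨e, he, f, hf, hef, rfl⟩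
    refine ⟨?_, e, f, hef, rfl⟩
    intro g hg
    simp only [Finset.mem_insert, Finset.mem_singleton] at hg
    rcases hg with rfl | rfl <;> assumption

theorem pair_biUnion (e f : Sym2 V) :
    ({e, f} : Finset (Sym2 V)).biUnion (edgeNbhd G) = edgeNbhd G e ∪ edgeNbhd G f := by
  simp

/-- Liar's domination in terms of `2`-ve domination and pairs of edges. -/
theorem isLiarVEDominating_iff {L : Finset V} : IsLiarVEDominating G L ↔
    IsKVEDominating G 2 L ∧
      ∀ P ∈ G.edgeFinset.powersetCard 2, 3 ≤ (P.biUnion (edgeNbhd G) ∩ L).card := by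
  refine and_congr_right fun _ => ⟨fun h P hP => ?_, fun h e he f hf hef => ?_⟩
  · obtain ⟨e, he, f, hf, hef, rfl⟩ := mem_pairs.1 hP
    rw [pair_biUnion]
    exact h e he f hf hef
  · rw [← pair_biUnion]
    exact h _ (mem_pairs.2 ⟨e, he, f, hf, hef, rfl⟩)

theorem three_le_card_pair_biUnion {P : Finset (Sym2 V)} (hP : P ∈ G.edgeFinset.powersetCard 2) :
    3 ≤ (P.biUnion (edgeNbhd G)).card := by
  obtain ⟨e, he, f, hf, hef, rfl⟩ := mem_pairs.1 hP
  rw [pair_biUnion]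
  exact three_le_card_union_edgeNbhd he hf hef

theorem two_le_card_pair_inter {D : Finset V} (hD : IsKVEDominating G 2 D)
    {P : Finset (Sym2 V)} (hP : P ∈ G.edgeFinset.powersetCard 2) :
    2 ≤ (P.biUnion (edgeNbhd G) ∩ D).card := by
  obtain ⟨e, he, f, hf, hef, rfl⟩ := mem_pairs.1 hP
  rw [pair_biUnion]
  exact (hD e he).trans
    (Finset.card_le_card (Finset.inter_subset_inter_right Finset.subset_union_left))

/-- If `N[e] ∪ N[f]` meets `D` in two points only, then `N[e]` and `N[f]` have the same trace on
`D`. One edge of the pair is near `v`, and the other is near any fixed point of this common trace;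
each leaves at most `Δ ^ 2` choices. -/
theorem card_pairsCoveredBy_le {D : Finset V} (hD : IsKVEDominating G 2 D) (v : V) :
    (pairsCoveredBy G D v).card ≤ G.maxDegree ^ 4 := by
  set A := G.edgeFinset.filter fun e => v ∈ edgeNbhd G e with hA
  set B : Sym2 V → Finset (Sym2 V) := fun e =>
    G.edgeFinset.filter fun f => edgeNbhd G f ∩ D = edgeNbhd G e ∩ D with hB
  have hBcard : ∀ e ∈ A, ((B e).image fun f => ({e, f} : Finset (Sym2 V))).card ≤
      G.maxDegree ^ 2 := by
    intro e he
    refine Finset.card_image_le.trans ?_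
    have h2 := hD e (Finset.mem_filter.1 he).1
    obtain ⟨a, ha⟩ : (edgeNbhd G e ∩ D).Nonempty := Finset.card_pos.1 (by omega)
    refine (Finset.card_le_card fun f hf => ?_).trans (card_edges_near_le (G := G) a)
    obtain ⟨hf, hfe⟩ := Finset.mem_filter.1 hf
    exact Finset.mem_filter.2 ⟨hf, (Finset.mem_inter.1 (hfe ▸ ha)).1⟩
  have hsub : pairsCoveredBy G D v ⊆
      A.biUnion fun e => (B e).image fun f => ({e, f} : Finset (Sym2 V)) := by
    intro P hP
    obtain ⟨hP, hv⟩ := Finset.mem_filter.1 hP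
    obtain ⟨hP, hc⟩ := Finset.mem_filter.1 hP
    obtain ⟨e, he, f, hf, hef, rfl⟩ := mem_pairs.1 hP
    rw [pair_biUnion] at hv hc
    have h1 : edgeNbhd G e ∩ D = (edgeNbhd G e ∪ edgeNbhd G f) ∩ D :=
      Finset.eq_of_subset_of_card_le (Finset.inter_subset_inter_right Finset.subset_union_left)
        (hc.trans_le (hD e he))
    have h2 : edgeNbhd G f ∩ D = (edgeNbhd G e ∪ edgeNbhd G f) ∩ D :=
      Finset.eq_of_subset_of_card_le (Finset.inter_subset_inter_right Finset.subset_union_right)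
        (hc.trans_le (hD f hf))
    rcases Finset.mem_union.1 hv with hv | hv
    · exact Finset.mem_biUnion.2 ⟨e, Finset.mem_filter.2 ⟨he, hv⟩, Finset.mem_image.2
        ⟨f, Finset.mem_filter.2 ⟨hf, h2.trans h1.symm⟩, rfl⟩⟩
    · exact Finset.mem_biUnion.2 ⟨f, Finset.mem_filter.2 ⟨hf, hv⟩, Finset.mem_image.2
        ⟨e, Finset.mem_filter.2 ⟨he, h1.trans h2.symm⟩, Finset.pair_comm _ _⟩⟩
  refine (Finset.card_le_card hsub).trans ((Finset.card_biUnion_le_card_mul _ _ _ hBcard).trans ?_)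
  rw [show G.maxDegree ^ 4 = G.maxDegree ^ 2 * G.maxDegree ^ 2 by ring]
  exact Nat.mul_le_mul_right _ (card_edges_near_le v)

theorem gain_edges_le (L : Finset V) (v : V) :
    gain G.edgeFinset (edgeNbhd G) 2 L v ≤ G.maxDegree ^ 2 := by
  refine (Finset.card_le_card fun e he => ?_).trans (card_edges_near_le v)
  obtain ⟨he, ⟨_, hv⟩, _⟩ := Finset.mem_filter.1 he
  exact Finset.mem_filter.2 ⟨he, hv⟩

/-- Exactly two points is the same as unmet demand 3, since 2-ve domination supplies two already. -/
theorem mem_doublyDominatedPairs {D : Finset V} (hD : IsKVEDominating G 2 D)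
    {P : Finset (Sym2 V)} : P ∈ doublyDominatedPairs G D ↔
      P ∈ G.edgeFinset.powersetCard 2 ∧ (P.biUnion (edgeNbhd G) ∩ D).card < 3 := by
  rw [doublyDominatedPairs, Finset.mem_filter]
  refine and_congr_right fun hP => ?_
  have := two_le_card_pair_inter hD hP
  omega

theorem IsKVEDominating.mono {k : ℕ} {D L : Finset V} (hD : IsKVEDominating G k D) (h : D ⊆ L) :
    IsKVEDominating G k L :=
  fun e he => (hD e he).trans (card_inter_mono _ h)

/-- The gain in the multicover problem for the pairs of edges is the number of the uncovered
pairs that a set contains. -/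
theorem card_pairsCoveredBy_inter {D L : Finset V} (hD : IsKVEDominating G 2 D) (h : D ⊆ L)
    {v : V} (hv : v ∉ D) : (pairsCoveredBy G D v ∩ doublyDominatedPairs G L).card =
      gain (G.edgeFinset.powersetCard 2) (fun P => P.biUnion (edgeNbhd G)) 3 L v := by
  rw [gain]
  congr 1
  ext P
  rw [Finset.mem_inter, pairsCoveredBy, Finset.mem_filter, mem_doublyDominatedPairs hD,
    mem_doublyDominatedPairs (hD.mono h), Finset.mem_filter]
  constructor
  -- A pair containing some `v ∈ L \ D` has two points from `D` and the further point `v`, so it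
  -- would be satisfied.
  · rintro ⟨⟨⟨hP, hc⟩, hvP⟩, -, hc'⟩
    refine ⟨hP, ⟨fun hvL => ?_, hvP⟩, hc'⟩
    have h1 := card_inter_insert hv hvP
    have h2 := card_inter_mono (P.biUnion (edgeNbhd G)) (Finset.insert_subset hvL h)
    have h3 := two_le_card_pair_inter hD hP
    omega
  · rintro ⟨hP, ⟨hvL, hvP⟩, hc⟩
    exact ⟨⟨⟨hP, (card_inter_mono _ h).trans_lt hc⟩, hvP⟩, hP, hc⟩

/-- The uncovered pairs at any moment are those doubly dominated by the current set: inserting `v`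
supplies the single missing point to exactly the pairs in `S_v`. -/
theorem GreedyRun.greedySetCover {D L L' : Finset V} {l : List V} (hD : IsKVEDominating G 2 D)
    (h : D ⊆ L)
    (hrun : GreedyRun (G.edgeFinset.powersetCard 2) (fun P => P.biUnion (edgeNbhd G)) 3 L l L')
    (hL' : ∀ P ∈ G.edgeFinset.powersetCard 2, 3 ≤ (P.biUnion (edgeNbhd G) ∩ L').card) :
    GreedySetCover (pairsCoveredBy G D) (Finset.univ \ D) (doublyDominatedPairs G L) l := by
  induction hrun with
  | nil L =>
    have : doublyDominatedPairs G L = ∅ := by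
      refine Finset.eq_empty_of_forall_notMem fun P hP => ?_
      obtain ⟨hP, hc⟩ := Finset.mem_filter.1 hP
      have := hL' P hP
      omega
    rw [this]
    exact .done
  | @cons L L' v l hpos hmax _ ih =>
    have hv := notMem_of_gain_ne_zero hpos
    have hvD : v ∉ D := fun hvD => hv (h hvD)
    have hins : doublyDominatedPairs G L \ pairsCoveredBy G D v =
        doublyDominatedPairs G (insert v L) := by
      ext P
      rw [Finset.mem_sdiff, pairsCoveredBy, Finset.mem_filter, mem_doublyDominatedPairs hD,
        mem_doublyDominatedPairs (hD.mono h),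
        mem_doublyDominatedPairs (hD.mono (h.trans (Finset.subset_insert v L)))]
      constructor
      · rintro ⟨⟨hP, hc⟩, hn⟩
        have hvP : v ∉ P.biUnion (edgeNbhd G) := fun hvP =>
          hn ⟨⟨hP, (card_inter_mono _ h).trans_lt hc⟩, hvP⟩
        rw [Finset.inter_insert_of_notMem hvP]
        exact ⟨hP, hc⟩
      · rintro ⟨hP, hc⟩
        refine ⟨⟨hP, (card_inter_mono _ (Finset.subset_insert v L)).trans_lt hc⟩, ?_⟩
        rintro ⟨-, hvP⟩
        have h1 := card_inter_insert hv hvP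
        have h3 := two_le_card_pair_inter (hD.mono h) hP
        omega
    refine .choose _ v l ?_ (by simpa using hvD) (fun j hj => ?_) ?_
    · have h1 := card_pairsCoveredBy_inter hD h hvD
      obtain ⟨P, hP⟩ : (pairsCoveredBy G D v ∩ doublyDominatedPairs G L).Nonempty :=
        Finset.card_pos.1 (by omega)
      exact ⟨P, (Finset.mem_inter.1 hP).2⟩
    · rw [card_pairsCoveredBy_inter hD h (by simpa using hj), card_pairsCoveredBy_inter hD h hvD]
      exact hmax j
    · rw [hins]
      exact ih (h.trans (Finset.subset_insert v L)) hL'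

end Bounds

/-! ### Counting edges and pairs of edges by tuples of vertices -/

section Counting

/-- The edges of a graph on `Fin n`, listed as increasing pairs. -/
def orderedEdges {n : ℕ} (G : SimpleGraph (Fin n)) [DecidableRel G.Adj] :
    Finset (Fin n × Fin n) :=
  Finset.univ.filter fun p => p.1 < p.2 ∧ G.Adj p.1 p.2

variable {n : ℕ} {G : SimpleGraph (Fin n)} [DecidableRel G.Adj]

theorem exists_orderedEdges {e : Sym2 (Fin n)} (he : e ∈ G.edgeFinset) :
    ∃ p ∈ orderedEdges G, s(p.1, p.2) = e := by
  induction e with | _ x y =>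
  have hxy : G.Adj x y := by simpa using he
  rcases lt_or_gt_of_ne hxy.ne with h | h
  · exact ⟨(x, y), by simp [orderedEdges, h, hxy], rfl⟩
  · exact ⟨(y, x), by simp [orderedEdges, h, hxy.symm], Sym2.eq_swap⟩

theorem mk_mem_edgeFinset {p : Fin n × Fin n} (hp : p ∈ orderedEdges G) :
    s(p.1, p.2) ∈ G.edgeFinset := by
  simpa using (Finset.mem_filter.1 hp).2.2

theorem orderedEdges_injOn {p q : Fin n × Fin n} (hp : p ∈ orderedEdges G)
    (hq : q ∈ orderedEdges G) (h : s(p.1, p.2) = s(q.1, q.2)) : p = q := by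
  have hp := (Finset.mem_filter.1 hp).2.1
  have hq := (Finset.mem_filter.1 hq).2.1
  rcases Sym2.eq_iff.1 h with ⟨h1, h2⟩ | ⟨h1, h2⟩
  · exact Prod.ext h1 h2
  · rw [h1, h2] at hp
    exact absurd hp hq.asymm

theorem card_filter_edges (Q : Sym2 (Fin n) → Prop) [DecidablePred Q] :
    (G.edgeFinset.filter Q).card =
      ((orderedEdges G).filter fun p => Q s(p.1, p.2)).card := by
  symm
  refine Finset.card_bij (fun p _ => s(p.1, p.2)) ?_ ?_ ?_
  · intro p hp
    obtain ⟨hp, hQ⟩ := Finset.mem_filter.1 hp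
    exact Finset.mem_filter.2 ⟨mk_mem_edgeFinset hp, hQ⟩
  · exact fun p hp q hq h =>
      orderedEdges_injOn (Finset.mem_filter.1 hp).1 (Finset.mem_filter.1 hq).1 h
  · intro e he
    obtain ⟨he, hQ⟩ := Finset.mem_filter.1 he
    obtain ⟨p, hp, rfl⟩ := exists_orderedEdges he
    exact ⟨p, Finset.mem_filter.2 ⟨hp, hQ⟩, rfl⟩

/-- The lexicographic order on pairs. -/
def LexLT (p q : Fin n × Fin n) : Prop := p.1 < q.1 ∨ (p.1 = q.1 ∧ p.2 < q.2)

instance (p q : Fin n × Fin n) : Decidable (LexLT p q) := by unfold LexLT; infer_instance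

theorem LexLT.trichotomous {p q : Fin n × Fin n} (h : p ≠ q) : LexLT p q ∨ LexLT q p := by
  have : ¬ (p.1 = q.1 ∧ p.2 = q.2) := fun hpq => h (Prod.ext hpq.1 hpq.2)
  unfold LexLT
  omega

theorem LexLT.asymm {p q : Fin n × Fin n} (h : LexLT p q) : ¬ LexLT q p := by
  unfold LexLT at *
  omega

/-- The lexicographic order selects one of the two orderings of each pair of edges, so a fourfold
sum over vertices counts every pair once. -/
theorem card_filter_pairs (Q : Finset (Sym2 (Fin n)) → Prop) [DecidablePred Q] :
    ((G.edgeFinset.powersetCard 2).filter Q).card =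
      ((orderedEdges G ×ˢ orderedEdges G).filter fun p =>
        LexLT p.1 p.2 ∧ Q {s(p.1.1, p.1.2), s(p.2.1, p.2.2)}).card := by
  symm
  refine Finset.card_bij (fun p _ => {s(p.1.1, p.1.2), s(p.2.1, p.2.2)}) ?_ ?_ ?_
  · rintro ⟨p, q⟩ hp
    simp only [Finset.mem_filter, Finset.mem_product] at hp
    obtain ⟨⟨hp, hq⟩, hlt, hQ⟩ := hp
    refine Finset.mem_filter.2 ⟨mem_pairs.2 ⟨_, mk_mem_edgeFinset hp, _, mk_mem_edgeFinset hq,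
      fun h => ?_, rfl⟩, hQ⟩
    obtain rfl := orderedEdges_injOn hp hq h
    exact hlt.asymm hlt
  · rintro ⟨p, q⟩ hp ⟨p', q'⟩ hp' h
    simp only [Finset.mem_filter, Finset.mem_product] at hp hp'
    obtain ⟨⟨hp, hq⟩, hlt, -⟩ := hp
    obtain ⟨⟨hp', hq'⟩, hlt', -⟩ := hp'
    have h1 : s(p.1, p.2) = s(p'.1, p'.2) ∨ s(p.1, p.2) = s(q'.1, q'.2) := by
      have : s(p.1, p.2) ∈ ({s(p'.1, p'.2), s(q'.1, q'.2)} : Finset (Sym2 (Fin n))) := by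
        rw [← h]; simp
      simpa only [Finset.mem_insert, Finset.mem_singleton] using this
    have h2 : s(q.1, q.2) = s(p'.1, p'.2) ∨ s(q.1, q.2) = s(q'.1, q'.2) := by
      have : s(q.1, q.2) ∈ ({s(p'.1, p'.2), s(q'.1, q'.2)} : Finset (Sym2 (Fin n))) := by
        rw [← h]; simp
      simpa only [Finset.mem_insert, Finset.mem_singleton] using this
    rcases h1 with h1 | h1 <;> rcases h2 with h2 | h2
    · obtain rfl := orderedEdges_injOn hp hp' h1
      obtain rfl := orderedEdges_injOn hq hp' h2
      exact absurd hlt hlt.asymm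
    · obtain rfl := orderedEdges_injOn hp hp' h1
      obtain rfl := orderedEdges_injOn hq hq' h2
      rfl
    · obtain rfl := orderedEdges_injOn hp hq' h1
      obtain rfl := orderedEdges_injOn hq hp' h2
      exact absurd hlt hlt'.asymm
    · obtain rfl := orderedEdges_injOn hp hq' h1
      obtain rfl := orderedEdges_injOn hq hq' h2
      exact absurd hlt hlt.asymm
  · intro P hP
    obtain ⟨hP, hQ⟩ := Finset.mem_filter.1 hP
    obtain ⟨e, he, f, hf, hef, rfl⟩ := mem_pairs.1 hP
    obtain ⟨p, hp, rfl⟩ := exists_orderedEdges he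
    obtain ⟨q, hq, rfl⟩ := exists_orderedEdges hf
    rcases LexLT.trichotomous (p := p) (q := q) (by rintro rfl; exact hef rfl) with h | h
    · exact ⟨(p, q), by simp [hp, hq, h, hQ], rfl⟩
    · exact ⟨(q, p), by simpa [hp, hq, h, Finset.pair_comm] using hQ, Finset.pair_comm _ _⟩

end Counting

end LVED

/-! ### The greedy program and its correctness -/

namespace RAM

open LVED

section Phase

variable {n : ℕ}

/-- The memory holds the graph `G` and the set `L`. -/
structure Represents (G : SimpleGraph (Fin n)) [DecidableRel G.Adj] (L : Finset (Fin n))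
    (s : State) : Prop where
  reg_zero : s.reg 0 = n
  adj : ∀ u v : Fin n, s.arr 0 (u.val * n + v.val) = if G.Adj u v then 1 else 0
  set : ∀ v : Fin n, s.arr 1 v.val = if v ∈ L then 1 else 0

variable {G : SimpleGraph (Fin n)} [DecidableRel G.Adj] {L : Finset (Fin n)} {s : State}

theorem represents_inputState (G : SimpleGraph (Fin n)) [DecidableRel G.Adj] :
    Represents G ∅ (inputState G) where
  reg_zero := rfl
  adj u v := by
    have hinj : ∀ u' v' : Fin n, u.val * n + v.val = u'.val * n + v'.val → u = u' ∧ v = v' := by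
      intro u' v' h
      have hn : 0 < n := u.pos
      have h1 := congrArg (· / n) h
      have h2 := congrArg (· % n) h
      simp only [Nat.add_comm (_ * n), Nat.add_mul_div_right _ _ hn,
        Nat.div_eq_of_lt v.isLt, Nat.div_eq_of_lt v'.isLt, zero_add,
        Nat.add_mul_mod_self_right, Nat.mod_eq_of_lt v.isLt, Nat.mod_eq_of_lt v'.isLt] at h1 h2
      exact ⟨Fin.ext h1, Fin.ext h2⟩
    simp only [inputState, true_and]
    refine if_congr ⟨?_, fun h => ⟨u, v, rfl, h⟩⟩ rfl rfl
    rintro ⟨u', v', h, hadj⟩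
    obtain ⟨rfl, rfl⟩ := hinj u' v' h
    exact hadj
  set v := by simp [inputState]

namespace Represents

theorem congr (h : Represents G L s) {s' : State} (h0 : s'.reg 0 = s.reg 0)
    (ha : s'.arr = s.arr) : Represents G L s' :=
  ⟨h0.trans h.reg_zero, by simpa [ha] using h.adj, by simpa [ha] using h.set⟩

theorem setReg (h : Represents G L s) {i : ℕ} (hi : i ≠ 0) (x : ℕ) :
    Represents G L (s.setReg i x) :=
  h.congr (by simp [hi.symm]) rfl

theorem store (h : Represents G L s) (v : Fin n) {L' : Finset (Fin n)}
    (hL' : ∀ u, u ≠ v → (u ∈ L' ↔ u ∈ L)) :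
    Represents G L' (s.setArr 1 v.val (if v ∈ L' then 1 else 0)) where
  reg_zero := h.reg_zero
  adj x y := by simpa [State.arr_setArr] using h.adj x y
  set u := by
    rw [State.arr_setArr]
    by_cases huv : u = v
    · simp [huv]
    · simp [Fin.val_inj, huv, h.set, hL' u huv]

theorem vertexSet_eq (h : Represents G L s) : s.vertexSet n = L := by
  ext v
  simp [State.vertexSet, h.set]

theorem eval_sum (h : Represents G L s) (v : ℕ) (e : Expr) :
    (Expr.sum v e).eval s = ∑ x : Fin n, e.eval (s.setReg v x.val) := by
  rw [Expr.eval, h.reg_zero, Finset.sum_range]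

end Represents

/-- `v` offers the largest gain, and this is not `0`. -/
def IsGreedyChoice {α : Type*} (X : Finset α) (N : α → Finset (Fin n)) (r : ℕ)
    (L : Finset (Fin n)) (v : Fin n) : Prop :=
  gain X N r L v ≠ 0 ∧ ∀ u, gain X N r L u ≤ gain X N r L v

/-- The new value of the indicator vector at the vertex in register `2`, if `W i` is the gain of
the vertex in register `i`. -/
def choiceExpr (W : ℕ → Expr) : Expr :=
  .or (.arr 1 (.var 2)) (.and (W 2) (.not (.sum 3 (.lt (W 2) (W 3)))))

/-- The greedy algorithm: `n` passes over the vertices, each vertex being chosen if it offers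
the largest gain at that moment. -/
def greedyCmd (W : ℕ → Expr) : Cmd :=
  forCmd 1 10 (forCmd 2 10 (.seq ((choiceExpr W).compile 10) (.store 1 2 10)))

/-- `W i` computes the gain of the vertex in register `i`. -/
def ComputesGain {α : Type*} (G : SimpleGraph (Fin n)) [DecidableRel G.Adj] (X : Finset α)
    (N : α → Finset (Fin n)) (r : ℕ) (W : ℕ → Expr) : Prop :=
  ∀ (L : Finset (Fin n)) (s : State), Represents G L s → ∀ i ∈ ({2, 3} : Finset ℕ), ∀ v : Fin n,
    s.reg i = v.val → (W i).eval s = gain X N r L v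

variable {α : Type*} {X : Finset α} {N : α → Finset (Fin n)} {r : ℕ} {W : ℕ → Expr}

open Classical in
theorem eval_choiceExpr (hW : ComputesGain G X N r W) (h : Represents G L s) {v : Fin n}
    (hv : s.reg 2 = v.val) :
    (choiceExpr W).eval s = if v ∈ L ∨ IsGreedyChoice X N r L v then 1 else 0 := by
  rw [choiceExpr, Expr.eval_or]
  refine if_congr (or_congr ?_ ?_) rfl rfl
  · simp [Expr.eval, hv, h.set]
  · rw [Expr.eval_and, IsGreedyChoice]
    have h2 : (W 2).eval s = gain X N r L v := hW L s h 2 (by simp) v hv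
    have h3 : (Expr.sum 3 (.lt (W 2) (W 3))).eval s = 0 ↔
        ∀ u, gain X N r L u ≤ gain X N r L v := by
      have hu : ∀ u : Fin n, ((W 2).lt (W 3)).eval (s.setReg 3 u.val) = 0 ↔
          gain X N r L u ≤ gain X N r L v := by
        intro u
        have h' := h.setReg (i := 3) (by norm_num) u.val
        rw [← not_iff_not, ← ne_eq, Expr.eval_lt_ne_zero, not_le,
          hW L _ h' 2 (by simp) v (by simpa using hv), hW L _ h' 3 (by simp) u (by simp)]
      simp [h.eval_sum, hu]
    simp [h2, h3]

open Classical in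
/-- One pass of the greedy algorithm. -/
theorem exec_pass (hW : ComputesGain G X N r W) (hok : (choiceExpr W).ok 10)
    (h : Represents G L s) :
    ∃ t s' L' l, Exec (forCmd 2 10 (.seq ((choiceExpr W).compile 10) (.store 1 2 10))) s t s' ∧
      t ≤ n * ((choiceExpr W).cost.eval n + 4) + 2 ∧ Represents G L' s' ∧ s'.reg 1 = s.reg 1 ∧
      GreedyRun X N r L l L' ∧ (l = [] → ∀ v, gain X N r L v = 0) := by
  -- As long as nothing is chosen in this pass, the set is still `L`, so all the failed tests refer
  -- to the same gains.
  let I : ℕ → State → Prop := fun k s' => ∃ L' l, Represents G L' s' ∧ s'.reg 1 = s.reg 1 ∧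
    GreedyRun X N r L l L' ∧ (l = [] → ∀ v : Fin n, k ≤ v.val → ¬ IsGreedyChoice X N r L v)
  obtain ⟨t, s', hex, ht, L', l, hrep, h1, hrun, hl⟩ := exec_forCmd (v := 2) (o := 10)
    (c := .seq ((choiceExpr W).compile 10) (.store 1 2 10))
    (T := (choiceExpr W).cost.eval n + 1) I (by norm_num) s
    ⟨L, [], h.setReg (by norm_num) _, by simp, .nil L, fun _ v hv => by
      rw [h.reg_zero] at hv; exact absurd v.isLt (by omega)⟩ (by
    rintro k hk s' ⟨L', l, hrep, h1, hrun, hl⟩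
    rw [h.reg_zero] at hk
    have hrep' := (hrep.setReg (i := 10) (by norm_num) 1).setReg (i := 2) (by norm_num) k
    obtain ⟨t, s'', hex, ht, hv, hr, ha⟩ := Expr.exec_compile (choiceExpr W) 10
      ((s'.setReg 10 1).setReg 2 k) (by norm_num) hok
    rw [hrep'.reg_zero] at ht
    have hrep'' : Represents G L' s'' := hrep'.congr (hr 0 (by norm_num)) ha
    have h2 : s''.reg 2 = k := by rw [hr 2 (by norm_num)]; simp
    have h1' : s''.reg 1 = s.reg 1 := by rw [hr 1 (by norm_num)]; simpa using h1
    rw [eval_choiceExpr hW hrep' (v := ⟨k, hk⟩) (by simp)] at hv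
    have hst := Exec.store s'' 1 2 10
    rw [hv, h2] at hst
    refine ⟨_, _, .seq hex hst, by omega, ?_, by simpa using h2⟩
    by_cases hc : IsGreedyChoice X N r L' ⟨k, hk⟩
    · refine ⟨insert ⟨k, hk⟩ L', l ++ [⟨k, hk⟩], ?_, by simpa using h1',
        hrun.trans (.cons hc.1 hc.2 (.nil _)), by simp⟩
      have := hrep''.store ⟨k, hk⟩ (L' := insert ⟨k, hk⟩ L') (fun u hu => by simp [hu])
      simpa [hc] using this
    · refine ⟨L', l, ?_, by simpa using h1', hrun, ?_⟩
      · have := hrep''.store ⟨k, hk⟩ (L' := L') (fun u hu => Iff.rfl)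
        simpa [hc] using this
      · rintro rfl v hkv
        rcases hkv.lt_or_eq with hkv | hkv
        · exact hl rfl v hkv
        · have : L' = L := by simpa using hrun.eq_union
          rw [this] at hc
          rwa [show v = ⟨k, hk⟩ from Fin.ext hkv.symm])
  rw [h.reg_zero] at ht
  refine ⟨t, s', L', l, hex, ht, hrep, h1, hrun, fun hnil v => ?_⟩
  -- After an empty pass not even a vertex of maximum gain is eligible, so the maximum is 0.
  obtain ⟨w, -, hw⟩ := Finset.exists_max_image Finset.univ (gain X N r L) ⟨v, Finset.mem_univ v⟩
  by_contra hv
  have hwv := hw v (Finset.mem_univ v)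
  exact hl hnil w (Nat.zero_le _) ⟨by omega, fun u => hw u (Finset.mem_univ u)⟩

/-- A bound for the number of steps of the greedy algorithm. -/
noncomputable def greedyTime (W : ℕ → Expr) : Polynomial ℕ :=
  Polynomial.X * (Polynomial.X * ((choiceExpr W).cost + 4) + 5) + 2

theorem exec_greedyCmd (hW : ComputesGain G X N r W) (hok : (choiceExpr W).ok 10)
    (h : Represents G L s) :
    ∃ t s' L' l, Exec (greedyCmd W) s t s' ∧ t ≤ (greedyTime W).eval n ∧ Represents G L' s' ∧
      GreedyRun X N r L l L' ∧ ∀ v, gain X N r L' v = 0 := by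
  -- Every nonempty pass adds a vertex. With `k` passes left, either at least `n - k` vertices are
  -- in the set or no gain remains; at `k = 0` the first case gives all of `Fin n`.
  let I : ℕ → State → Prop := fun k s' => ∃ L' l, Represents G L' s' ∧
    GreedyRun X N r L l L' ∧ (n ≤ L'.card + k ∨ ∀ v, gain X N r L' v = 0)
  obtain ⟨t, s', hex, ht, L', l, hrep, hrun, hl⟩ := exec_forCmd (v := 1) (o := 10)
    (c := forCmd 2 10 (.seq ((choiceExpr W).compile 10) (.store 1 2 10)))
    (T := n * ((choiceExpr W).cost.eval n + 4) + 2) I (by norm_num) s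
    ⟨L, [], h.setReg (by norm_num) _, .nil L, .inl (by rw [h.reg_zero]; omega)⟩ (by
    rintro k - s' ⟨L', l, hrep, hrun, hl⟩
    obtain ⟨t, s'', L'', l', hex, ht, hrep', h1, hrun', hl'⟩ := exec_pass hW hok
      ((hrep.setReg (i := 10) (by norm_num) 1).setReg (i := 1) (by norm_num) k)
    refine ⟨t, s'', hex, ht, ⟨L'', l ++ l', hrep', hrun.trans hrun', ?_⟩, by simpa using h1⟩
    rcases eq_or_ne l' [] with rfl | hne
    · have : L'' = L' := by simpa using hrun'.eq_union
      rw [this]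
      exact .inr (hl' rfl)
    · rcases hl with hl | hl
      · have h2 := hrun'.card_eq
        have h3 := List.length_pos_iff.2 hne
        exact .inl (by omega)
      · refine .inr fun v => Nat.eq_zero_of_le_zero ?_
        rw [← hl v]
        exact gain_anti (hrun'.eq_union ▸ Finset.subset_union_left) v)
  rw [h.reg_zero] at ht
  refine ⟨t, s', L', l, hex, by simpa [greedyTime, add_assoc] using ht, hrep, hrun, ?_⟩
  rcases hl with hl | hl
  · have : L' = Finset.univ := by
      rw [← Finset.card_eq_iff_eq_univ, Fintype.card_fin]
      have := Finset.card_le_univ L'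
      rw [Fintype.card_fin] at this
      omega
    intro v
    simp [gain, this]
  · exact hl

end Phase

/-! ### Expressions for the gains -/

section Weights

/-- The expression for `G.Adj u v`, with `u` and `v` in the registers `i` and `j`. -/
def adjExpr (i j : ℕ) : Expr := .arr 0 (.add (.sum 9 (.var i)) (.var j))

/-- The expression for `w ∈ N[e]`, where `e = xy`. -/
def nbhdExpr (x y w : ℕ) : Expr :=
  .or (.or (.eq (.var w) (.var x)) (.eq (.var w) (.var y))) (.or (adjExpr x w) (adjExpr y w))

/-- The expression for `x < y` and `G.Adj x y`. -/
def edgeExpr (x y : ℕ) : Expr := .and (.lt (.var x) (.var y)) (adjExpr x y)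

/-- The expression for the condition that `v` is not in the set, that `B v` holds, and that `B z`
holds for less than `r` elements `z` of the set. -/
def helpsExpr (r : ℕ) (B : ℕ → Expr) (v : ℕ) : Expr :=
  .and (.and (.not (.arr 1 (.var v))) (B v))
    (.lt (.sum 8 (.and (B 8) (.arr 1 (.var 8)))) (.const r))

/-- The gain of the vertex in register `v` in phase 1. -/
def edgeGainExpr (v : ℕ) : Expr :=
  .sum 4 (.sum 5 (.and (edgeExpr 4 5) (helpsExpr 2 (nbhdExpr 4 5) v)))

/-- The expression for the lexicographic order on pairs. -/
def lexExpr (x y x' y' : ℕ) : Expr :=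
  .or (.lt (.var x) (.var x')) (.and (.eq (.var x) (.var x')) (.lt (.var y) (.var y')))

/-- The gain of the vertex in register `v` in phase 2. -/
def pairGainExpr (v : ℕ) : Expr :=
  .sum 4 (.sum 5 (.sum 6 (.sum 7 (.and (.and (edgeExpr 4 5) (edgeExpr 6 7))
    (.and (lexExpr 4 5 6 7)
      (helpsExpr 3 (fun w => .or (nbhdExpr 4 5 w) (nbhdExpr 6 7 w)) v))))))

variable {n : ℕ} {G : SimpleGraph (Fin n)} [DecidableRel G.Adj] {L : Finset (Fin n)} {s : State}

/-- The machine cannot multiply, so the row offset `u * n` is computed as a sum of `n` copies of `u`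
with dummy variable 9; hence `i ≠ 9`. -/
theorem eval_adjExpr (h : Represents G L s) {i j : ℕ} {u v : Fin n} (hi : s.reg i = u.val)
    (hj : s.reg j = v.val) (hi9 : i ≠ 9) : (adjExpr i j).eval s ≠ 0 ↔ G.Adj u v := by
  rw [adjExpr, Expr.eval, Expr.eval, h.eval_sum]
  simp [Expr.eval, hi9, hi, hj, mul_comm n, h.adj]

theorem eval_var_eq {i j : ℕ} {u v : Fin n} (hi : s.reg i = u.val)
    (hj : s.reg j = v.val) : (Expr.eq (.var i) (.var j)).eval s ≠ 0 ↔ u = v := by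
  rw [Expr.eval_eq_ne_zero, Expr.eval, Expr.eval, hi, hj, Fin.val_inj]

theorem eval_var_lt {i j : ℕ} {u v : Fin n} (hi : s.reg i = u.val)
    (hj : s.reg j = v.val) : (Expr.lt (.var i) (.var j)).eval s ≠ 0 ↔ u < v := by
  rw [Expr.eval_lt_ne_zero, Expr.eval, Expr.eval, hi, hj, Fin.lt_def]

theorem eval_and_ne_zero (e f : Expr) (s : State) :
    (e.and f).eval s ≠ 0 ↔ e.eval s ≠ 0 ∧ f.eval s ≠ 0 := by
  rw [Expr.eval_and]; simp

theorem eval_or_ne_zero (e f : Expr) (s : State) :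
    (e.or f).eval s ≠ 0 ↔ e.eval s ≠ 0 ∨ f.eval s ≠ 0 := by
  rw [Expr.eval_or]; simp; tauto

theorem eval_nbhdExpr (h : Represents G L s) {i j k : ℕ} {x y w : Fin n} (hi : s.reg i = x.val)
    (hj : s.reg j = y.val) (hk : s.reg k = w.val) (hi9 : i ≠ 9) (hj9 : j ≠ 9) :
    (nbhdExpr i j k).eval s ≠ 0 ↔ w ∈ edgeNbhd G s(x, y) := by
  rw [nbhdExpr, eval_or_ne_zero, eval_or_ne_zero, eval_or_ne_zero, eval_var_eq hk hi,
    eval_var_eq hk hj, eval_adjExpr h hi hk hi9, eval_adjExpr h hj hk hj9, mem_edgeNbhd_mk]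

theorem eval_edgeExpr (h : Represents G L s) {i j : ℕ} {x y : Fin n} (hi : s.reg i = x.val)
    (hj : s.reg j = y.val) (hi9 : i ≠ 9) :
    (edgeExpr i j).eval s ≠ 0 ↔ (x, y) ∈ orderedEdges G := by
  rw [edgeExpr, eval_and_ne_zero, eval_var_lt hi hj, eval_adjExpr h hi hj hi9]
  simp [orderedEdges]

theorem eval_lexExpr {i j i' j' : ℕ} {x y x' y' : Fin n} (hi : s.reg i = x.val)
    (hj : s.reg j = y.val) (hi' : s.reg i' = x'.val) (hj' : s.reg j' = y'.val) :
    (lexExpr i j i' j').eval s ≠ 0 ↔ LexLT (x, y) (x', y') := by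
  rw [lexExpr, eval_or_ne_zero, eval_and_ne_zero, eval_var_lt hi hi', eval_var_eq hi hi',
    eval_var_lt hj hj']
  rfl

theorem eval_helpsExpr (h : Represents G L s) {r i : ℕ} {B : ℕ → Expr} {A : Finset (Fin n)}
    {v : Fin n} (hi : s.reg i = v.val) (hBi : (B i).eval s ≠ 0 ↔ v ∈ A)
    (hB : ∀ z : Fin n, (B 8).eval (s.setReg 8 z.val) ≠ 0 ↔ z ∈ A) :
    (helpsExpr r B i).eval s ≠ 0 ↔ (v ∉ L ∧ v ∈ A) ∧ (A ∩ L).card < r := by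
  rw [helpsExpr, eval_and_ne_zero, eval_and_ne_zero, hBi, Expr.eval_lt_ne_zero, h.eval_sum]
  refine and_congr (and_congr_left' ?_) ?_
  · simp [Expr.eval, hi, h.set]
  · have : ∀ z : Fin n, (Expr.and (B 8) (.arr 1 (.var 8))).eval (s.setReg 8 z.val) =
        if z ∈ A ∩ L then 1 else 0 := by
      intro z
      rw [Expr.eval_and]
      refine if_congr ((and_congr (hB z) ?_).trans Finset.mem_inter.symm) rfl rfl
      simp [Expr.eval, h.set]
    simp only [this, Expr.eval, Finset.sum_boole, Nat.cast_id, Finset.filter_univ_mem]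

theorem computesGain_edges (G : SimpleGraph (Fin n)) [DecidableRel G.Adj] :
    ComputesGain G G.edgeFinset (edgeNbhd G) 2 edgeGainExpr := by
  intro L s h i hi v hv
  -- The candidate's register must not be captured by the summation variables.
  have hi' : i ≠ 4 ∧ i ≠ 5 ∧ i ≠ 8 := by
    simp only [Finset.mem_insert, Finset.mem_singleton] at hi; omega
  rw [gain, card_filter_edges, edgeGainExpr, h.eval_sum]
  have hpt : ∀ x y : Fin n, (Expr.and (edgeExpr 4 5) (helpsExpr 2 (nbhdExpr 4 5) i)).eval
      ((s.setReg 4 x.val).setReg 5 y.val) =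
      if (x, y) ∈ orderedEdges G ∧ ((v ∉ L ∧ v ∈ edgeNbhd G s(x, y)) ∧
        (edgeNbhd G s(x, y) ∩ L).card < 2) then 1 else 0 := by
    intro x y
    have h' := (h.setReg (i := 4) (by norm_num) x.val).setReg (i := 5) (by norm_num) y.val
    rw [Expr.eval_and]
    refine if_congr (and_congr (eval_edgeExpr h' (by simp) (by simp) (by norm_num)) ?_) rfl rfl
    refine eval_helpsExpr h' (by simp [hi', hv]) ?_ fun z => ?_
    · exact eval_nbhdExpr h' (by simp) (by simp) (by simp [hi', hv]) (by norm_num) (by norm_num)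
    · exact eval_nbhdExpr (h'.setReg (by norm_num) _) (by simp) (by simp) (by simp) (by norm_num)
        (by norm_num)
  simp only [(h.setReg (i := 4) (by norm_num) _).eval_sum, hpt]
  rw [← Fintype.sum_prod_type' (f := fun x y => if (x, y) ∈ orderedEdges G ∧
    ((v ∉ L ∧ v ∈ edgeNbhd G s(x, y)) ∧ (edgeNbhd G s(x, y) ∩ L).card < 2) then 1 else 0),
    ← Finset.card_filter]
  congr 1
  ext p
  simp

theorem computesGain_pairs (G : SimpleGraph (Fin n)) [DecidableRel G.Adj] :
    ComputesGain G (G.edgeFinset.powersetCard 2) (fun P => P.biUnion (edgeNbhd G)) 3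
      pairGainExpr := by
  intro L s h i hi v hv
  have hi' : i ≠ 4 ∧ i ≠ 5 ∧ i ≠ 6 ∧ i ≠ 7 ∧ i ≠ 8 := by
    simp only [Finset.mem_insert, Finset.mem_singleton] at hi; omega
  rw [gain, card_filter_pairs, pairGainExpr, h.eval_sum]
  have h4 := fun x : Fin n => h.setReg (i := 4) (by norm_num) x.val
  have h5 := fun x y : Fin n => (h4 x).setReg (i := 5) (by norm_num) y.val
  have h6 := fun x y x' : Fin n => (h5 x y).setReg (i := 6) (by norm_num) x'.val
  have h7 := fun x y x' y' : Fin n => (h6 x y x').setReg (i := 7) (by norm_num) y'.val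
  let Q : Fin n × Fin n → Fin n × Fin n → Prop := fun p q =>
    (p ∈ orderedEdges G ∧ q ∈ orderedEdges G) ∧ LexLT p q ∧
      ((v ∉ L ∧ v ∈ edgeNbhd G s(p.1, p.2) ∪ edgeNbhd G s(q.1, q.2)) ∧
        ((edgeNbhd G s(p.1, p.2) ∪ edgeNbhd G s(q.1, q.2)) ∩ L).card < 3)
  have hpt : ∀ x y x' y' : Fin n, (Expr.and (.and (edgeExpr 4 5) (edgeExpr 6 7))
      (.and (lexExpr 4 5 6 7)
        (helpsExpr 3 (fun w => .or (nbhdExpr 4 5 w) (nbhdExpr 6 7 w)) i))).eval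
      ((((s.setReg 4 x.val).setReg 5 y.val).setReg 6 x'.val).setReg 7 y'.val) =
      if Q (x, y) (x', y') then 1 else 0 := by
    intro x y x' y'
    have h' := h7 x y x' y'
    rw [Expr.eval_and]
    refine if_congr (and_congr ?_ ?_) rfl rfl
    · rw [eval_and_ne_zero]
      exact and_congr (eval_edgeExpr h' (by simp) (by simp) (by norm_num))
        (eval_edgeExpr h' (by simp) (by simp) (by norm_num))
    · rw [eval_and_ne_zero]
      refine and_congr (eval_lexExpr (by simp) (by simp) (by simp) (by simp)) ?_
      refine eval_helpsExpr h' (by simp [hi', hv]) ?_ fun z => ?_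
      · rw [eval_or_ne_zero, Finset.mem_union]
        exact or_congr
          (eval_nbhdExpr h' (by simp) (by simp) (by simp [hi', hv]) (by norm_num) (by norm_num))
          (eval_nbhdExpr h' (by simp) (by simp) (by simp [hi', hv]) (by norm_num) (by norm_num))
      · have h8 := h'.setReg (i := 8) (by norm_num) z.val
        rw [eval_or_ne_zero, Finset.mem_union]
        exact or_congr
          (eval_nbhdExpr h8 (by simp) (by simp) (by simp) (by norm_num) (by norm_num))
          (eval_nbhdExpr h8 (by simp) (by simp) (by simp) (by norm_num) (by norm_num))
  simp only [(h4 _).eval_sum, (h5 _ _).eval_sum, (h6 _ _ _).eval_sum, hpt]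
  have hsum : (∑ x, ∑ y, ∑ x', ∑ y', if Q (x, y) (x', y') then 1 else 0) =
      ∑ p : (Fin n × Fin n) × (Fin n × Fin n), if Q p.1 p.2 then 1 else 0 := by
    simp only [Fintype.sum_prod_type]
  rw [hsum, ← Finset.card_filter]
  congr 1
  ext p
  simp [Q, and_assoc]

end Weights

end RAM

/-! ### The approximation factor and the main theorem -/

theorem LVED.isBigO_factor : (fun Δ : ℕ => 2 * (3 * Real.log (Δ : ℝ) + 1)) =O[Filter.atTop]
    (fun Δ : ℕ => Real.log (Δ : ℝ)) := by
  -- The factor is `6 ln Δ + 2 ≤ 8 ln Δ` once `ln Δ ≥ 1`, which holds from `Δ = 3 > e` on.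
  refine Asymptotics.IsBigO.of_bound 8 ?_
  filter_upwards [Filter.eventually_ge_atTop 3] with n hn
  have h1 : 1 ≤ Real.log n := by
    rw [Real.le_log_iff_exp_le (by positivity)]
    have : (3 : ℝ) ≤ n := by exact_mod_cast hn
    linarith [Real.exp_one_lt_d9]
  rw [Real.norm_of_nonneg (by positivity), Real.norm_of_nonneg (by positivity)]
  linarith

theorem mainTheorem3 :
    (∃ (phase₁ phase₂ : RAM.Cmd) (time : Polynomial ℕ),
      ∀ (n : ℕ) (G : SimpleGraph (Fin n)) [DecidableRel G.Adj],
        ∃ (s₁ s₂ : RAM.State) (t₁ t₂ : ℕ) (D L : Finset (Fin n)),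
          -- the algorithm runs its two phases one after the other, in polynomial time;
          -- the first computes `D`, the second starts where the first halts and outputs `L`
          RAM.Exec phase₁ (RAM.inputState G) t₁ s₁ ∧
          RAM.Exec phase₂ s₁ t₂ s₂ ∧
          t₁ + t₂ ≤ time.eval n ∧
          D = s₁.vertexSet n ∧
          L = s₂.vertexSet n ∧
          -- `L` is a feasible solution, within the claimed factor of the optimum
          LVED.IsLiarVEDominating G L ∧
          (∀ L' : Finset (Fin n), LVED.IsLiarVEDominating G L' →
            (L.card : ℝ) ≤ 2 * (3 * Real.log (G.maxDegree : ℝ) + 1) * (L'.card : ℝ)) ∧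
          -- `D` is an approximate 2-ve dominating set
          LVED.IsKVEDominating G 2 D ∧
          (∀ D' : Finset (Fin n), LVED.IsKVEDominating G 2 D' →
            (D.card : ℝ) ≤ (2 * Real.log (G.maxDegree : ℝ) + 1) * (D'.card : ℝ)) ∧
          -- `L` is `D` together with a greedy cover of the pairs that `D` only doubly dominates
          (∃ l : List (Fin n),
            LVED.GreedySetCover (LVED.pairsCoveredBy G D) (Finset.univ \ D)
              (LVED.doublyDominatedPairs G D) l ∧
            L = D ∪ l.toFinset) ∧
          (∀ v ∈ Finset.univ \ D, (LVED.pairsCoveredBy G D v).card ≤ G.maxDegree ^ 4)) ∧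
    -- the factor is `O(ln Δ)`
    (fun Δ : ℕ => 2 * (3 * Real.log (Δ : ℝ) + 1)) =O[Filter.atTop]
      (fun Δ : ℕ => Real.log (Δ : ℝ)) := by
  refine ⟨⟨RAM.greedyCmd RAM.edgeGainExpr, RAM.greedyCmd RAM.pairGainExpr,
    RAM.greedyTime RAM.edgeGainExpr + RAM.greedyTime RAM.pairGainExpr, fun n G _ => ?_⟩,
    LVED.isBigO_factor⟩
  obtain ⟨t₁, s₁, D, l₁, hex₁, ht₁, hrep₁, hrun₁, hgain₁⟩ := RAM.exec_greedyCmd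
    (RAM.computesGain_edges G) (by decide) (RAM.represents_inputState G)
  obtain ⟨t₂, s₂, L, l₂, hex₂, ht₂, hrep₂, hrun₂, hgain₂⟩ := RAM.exec_greedyCmd
    (RAM.computesGain_pairs G) (by decide) hrep₁
  have hD : LVED.IsKVEDominating G 2 D :=
    LVED.covered_of_gain_eq_zero hgain₁ fun e he => LVED.two_le_card_edgeNbhd he
  have hL := LVED.covered_of_gain_eq_zero hgain₂ fun P hP => LVED.three_le_card_pair_biUnion hP
  have hDL : D ⊆ L := hrun₂.eq_union ▸ Finset.subset_union_left
  have hS : ∀ v ∈ Finset.univ \ D, (LVED.pairsCoveredBy G D v).card ≤ G.maxDegree ^ 4 :=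
    fun v _ => LVED.card_pairsCoveredBy_le hD v
  have hDle : ∀ D' : Finset (Fin n), LVED.IsKVEDominating G 2 D' →
      (D.card : ℝ) ≤ (2 * Real.log (G.maxDegree : ℝ) + 1) * (D'.card : ℝ) := by
    intro D' hD'
    have h := hrun₁.length_le_mul_log (M := D') (p := 2) hD hD' fun v _ =>
      LVED.gain_edges_le ∅ v
    rw [hrun₁.card_eq]
    simpa using h
  refine ⟨s₁, s₂, t₁, t₂, D, L, hex₁, hex₂, ?_, hrep₁.vertexSet_eq.symm,
    hrep₂.vertexSet_eq.symm, LVED.isLiarVEDominating_iff.2 ⟨hD.mono hDL, hL⟩, ?_, hD, hDle,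
    ⟨l₂, hrun₂.greedySetCover hD subset_rfl hL, hrun₂.eq_union⟩, hS⟩
  · rw [Polynomial.eval_add]
    omega
  · intro L' hL'
    obtain ⟨hL'₂, hL'₃⟩ := LVED.isLiarVEDominating_iff.1 hL'
    have h1 := hDle L' hL'₂
    -- At the start of phase 2 the gain of a vertex `v ∉ D` counts pairs in `S_v`, hence the
    -- exponent 4.
    have h2 := hrun₂.length_le_mul_log (M := L') (m := G.maxDegree) (p := 4) hL hL'₃
      fun v hv => by
        rw [← LVED.card_pairsCoveredBy_inter hD subset_rfl hv]
        exact (Finset.card_le_card Finset.inter_subset_left).trans (hS v (by simpa using hv))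
    rw [hrun₂.card_eq]
    push_cast at h2 ⊢
    linarith
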